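/- Let $s\ge 2$ and let $X$ be a smooth manifold of dimension $2(s+1)$ with a (pointwise) $s$-Kähler structure of rank two: a Riemannian metric and two-forms $\omega_{jk}$ ($0\le j,k\le s$) such that each cotangent space $T_p^*X$ has an adapted coframe, i.e. an orthonormal basis $v_{ij}$ ($i=1,2$, $j=0,\dots,s$) with $\omega_{jk}=v_{1j}\wedge v_{1k}+v_{2j}\wedge v_{2k}$. Fix $p\in X$ and an adapted coframe $(v_{ij})$ at $p$. Let $J$ be the derivation of $\bigwedge^*T_p^*X$ with $J v_{1j}=v_{2j}$, $J v_{2j}=-v_{1j}$. On $\bigwedge^*T_p^*X$ let $L_{jk}(\phi)=\omega_{jk}\wedge\phi$ ($j\ne k$), $V_j(\phi)=v_{1j}\wedge v_{2j}\wedge\phi$, and let $\Lambda_{jk}=L_{jk}^*$, $A_j=V_j^*$ be their adjoints for the induced metric. Let $\mathcal L^s_{\mathbb R,p}\subset \mathrm{End}_{\mathbb R}(\bigwedge^*T_p^*X)$ be the real Lie algebra generated by all $L_{jk},V_j,\Lambda_{jk},A_j$; it acts complex linearly on $\bigwedge^*_{\mathbb C}T_p^*X$. Put $w_j=\frac1{\sqrt2}(v_{1j}+\sqrt{-1}\,v_{2j})$,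 let $\mathcal I_{-s}\subset\bigwedge^*_{\mathbb C}T^*_pX$ be the eigenspace of $J$ with eigenvalue $-s\sqrt{-1}$, and for $0\le r\le s$ let $$c_r=w_0\wedge\dots\wedge\widehat{w_r}\wedge\dots\wedge w_s,\qquad c_{s+1+r}=w_0\wedge\dots\wedge w_r\wedge\overline w_r\wedge\dots\wedge w_s .$$ Then $c_0,\dots,c_{2s+1}$ is a complex basis of $\mathcal I_{-s}$, the algebra $\mathcal L^s_{\mathbb R,p}$ preserves $\mathcal I_{-s}$, and sending an operator to the matrix, in the basis $\{c_i\}$, of its restriction to $\mathcal I_{-s}$ is an injective homomorphism of real Lie algebras whose image is exactly the set of all block matrices $$\begin{pmatrix} D & H_2\\ H_1 & -\overline D^{\,t}\end{pmatrix}$$ of trace zero, where $D$ is a complex $(s+1)\times(s+1)$ matrix and $H_1,H_2$ are anti-Hermitian complex $(s+1)\times(s+1)$ matrices. (The trace is zero precisely when $\operatorname{tr}D$ is real.) -/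

import Mathlib

open scoped ContDiff Manifold TensorProduct Matrix

attribute [local instance 100] LieRing.ofAssociativeRing

noncomputable section

namespace SKahler

/-! ### Linear algebra of forms at a point

`W` plays the role of the cotangent space at a point, `ExteriorAlgebra ℝ W` that of the space of
real forms at this point, and `h` that of the metric on covectors. -/

section LinearAlgebra

variable {W : Type*} [AddCommGroup W] [Module ℝ W]

/-- The pairing induced by `h` on the `n`-th exterior power:
`(a₁ ∧ ⋯ ∧ aₙ, b₁ ∧ ⋯ ∧ bₙ) = det (h aᵢ bⱼ)`. -/
def powerMetric (h : LinearMap.BilinForm ℝ W) (n : ℕ) : LinearMap.BilinForm ℝ (⋀[ℝ]^n W) :=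
  (exteriorPower.pairingDual ℝ W n).comp (exteriorPower.map n h)

theorem powerMetric_ιMulti (h : LinearMap.BilinForm ℝ W) (n : ℕ) (a b : Fin n → W) :
    powerMetric h n (exteriorPower.ιMulti ℝ n a) (exteriorPower.ιMulti ℝ n b) =
      (Matrix.of fun i j => h (a i) (b j)).det := by
  rw [← Matrix.det_transpose]
  simp [powerMetric, Matrix.transpose, Function.comp_def]

/-- The degree `n` component of a form. -/
def component (n : ℕ) : ExteriorAlgebra ℝ W →ₗ[ℝ] ⋀[ℝ]^n W :=
  (DirectSum.component ℝ ℕ (fun i => ⋀[ℝ]^i W) n).comp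
    (DirectSum.decomposeLinearEquiv fun i => ⋀[ℝ]^i W).toLinearMap

/-- The metric induced by `h` on the whole exterior algebra: forms of different degrees are
orthogonal, and in degree `n` it is `powerMetric h n`. -/
def formMetric (h : LinearMap.BilinForm ℝ W) : LinearMap.BilinForm ℝ (ExteriorAlgebra ℝ W) :=
  (DirectSum.toModule ℝ ℕ (Module.Dual ℝ (ExteriorAlgebra ℝ W)) fun n =>
    (component n).dualMap.comp (powerMetric h n)).comp
      (DirectSum.decomposeLinearEquiv fun i => ⋀[ℝ]^i W).toLinearMap

theorem formMetric_apply (h : LinearMap.BilinForm ℝ W) (m : ℕ) (a : ⋀[ℝ]^m W)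
    (b : ExteriorAlgebra ℝ W) :
    formMetric h a b = powerMetric h m a (component m b) := by
  simp [formMetric]

theorem component_coe (m n : ℕ) (b : ⋀[ℝ]^n W) (h : m ≠ n) :
    component m (b : ExteriorAlgebra ℝ W) = 0 := by
  have key : component m (b : ExteriorAlgebra ℝ W) =
      DirectSum.component ℝ ℕ (fun i => ⋀[ℝ]^i W) m (DirectSum.lof ℝ ℕ _ n b) := by
    simp [component]
  rw [key, DirectSum.component.of, dif_neg (Ne.symm h)]

theorem component_coe_self (n : ℕ) (b : ⋀[ℝ]^n W) :
    component n (b : ExteriorAlgebra ℝ W) = b := by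
  simp [component, DirectSum.component.lof_self]

/-- The algebra map `w ↦ w + ε A w` from the exterior algebra to the dual numbers over it. -/
def derivationAux (A : Module.End ℝ W) :
    ExteriorAlgebra ℝ W →ₐ[ℝ] DualNumber (ExteriorAlgebra ℝ W) :=
  ExteriorAlgebra.lift ℝ
    ⟨(TrivSqZeroExt.inlAlgHom ℝ (ExteriorAlgebra ℝ W) (ExteriorAlgebra ℝ W)).toLinearMap.comp
        (ExteriorAlgebra.ι ℝ) +
      ((TrivSqZeroExt.inrHom (ExteriorAlgebra ℝ W) (ExteriorAlgebra ℝ W)).restrictScalars ℝ).comp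
        ((ExteriorAlgebra.ι ℝ).comp A), fun w => by
      ext
      · simp
      · simp [add_comm]⟩

/-- The extension of an endomorphism of `W` to a derivation of the exterior algebra. -/
def derivationExt (A : Module.End ℝ W) : Module.End ℝ (ExteriorAlgebra ℝ W) :=
  ((TrivSqZeroExt.sndHom (ExteriorAlgebra ℝ W) (ExteriorAlgebra ℝ W)).restrictScalars ℝ).comp
    (derivationAux A).toLinearMap

theorem derivationExt_ι (A : Module.End ℝ W) (w : W) :
    derivationExt A (ExteriorAlgebra.ι ℝ w) = ExteriorAlgebra.ι ℝ (A w) := by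
  simp [derivationExt, derivationAux]

theorem derivationExt_mul (A : Module.End ℝ W) (x y : ExteriorAlgebra ℝ W) :
    derivationExt A (x * y) = derivationExt A x * y + x * derivationExt A y := by
  have key : ∀ z, TrivSqZeroExt.fst (derivationAux A z) = z := by
    have : (TrivSqZeroExt.fstHom ℝ (ExteriorAlgebra ℝ W) (ExteriorAlgebra ℝ W)).comp
        (derivationAux A) = AlgHom.id ℝ _ := by
      ext w
      simp [derivationAux]
    exact fun z => DFunLike.congr_fun this z
  simp [derivationExt, key, add_comm]

/-- Wedge product (on the left) with a form. -/
def wedge (φ : ExteriorAlgebra ℝ W) : Module.End ℝ (ExteriorAlgebra ℝ W) :=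
  LinearMap.mulLeft ℝ φ

/-- An adapted coframe for a family `η` of two-forms on a Euclidean cotangent space, in rank two:
an orthonormal basis `v i j` (`i = 0, 1`, `j = 0, …, s`) of `W` such that
`η j k = v 0 j ∧ v 0 k + v 1 j ∧ v 1 k`. -/
structure AdaptedCoframe (s : ℕ) (h : LinearMap.BilinForm ℝ W)
    (η : Fin (s + 1) → Fin (s + 1) → ⋀[ℝ]^2 W) where
  basis : Module.Basis (Fin 2 × Fin (s + 1)) ℝ W
  orthonormal : ∀ a b, h (basis a) (basis b) = if a = b then 1 else 0
  form_eq : ∀ j k, (η j k : ExteriorAlgebra ℝ W) =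
    ∑ i : Fin 2, ExteriorAlgebra.ι ℝ (basis (i, j)) * ExteriorAlgebra.ι ℝ (basis (i, k))

namespace AdaptedCoframe

variable {s : ℕ} {h : LinearMap.BilinForm ℝ W} {η : Fin (s + 1) → Fin (s + 1) → ⋀[ℝ]^2 W}

/-- The covector `v i j`, as a one-form. -/
def form (v : AdaptedCoframe s h η) (i : Fin 2) (j : Fin (s + 1)) : ExteriorAlgebra ℝ W :=
  ExteriorAlgebra.ι ℝ (v.basis (i, j))

/-- The complex structure on covectors: `v 0 j ↦ v 1 j`, `v 1 j ↦ - v 0 j`. -/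
def complexStructure (v : AdaptedCoframe s h η) : Module.End ℝ W :=
  v.basis.constr ℝ fun a => if a.1 = 0 then v.basis (1, a.2) else - v.basis (0, a.2)

/-- The determination of the operator `J` on forms given by the coframe: the derivation extending
the complex structure on covectors. -/
def J (v : AdaptedCoframe s h η) : Module.End ℝ (ExteriorAlgebra ℝ W) :=
  derivationExt v.complexStructure

/-- `L j k`, the wedge product with `η j k`. -/
def L (_v : AdaptedCoframe s h η) (j k : Fin (s + 1)) : Module.End ℝ (ExteriorAlgebra ℝ W) :=
  wedge (η j k : ExteriorAlgebra ℝ W)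

/-- `V j`, the wedge product with the volume form of the plane spanned by `v 0 j, v 1 j`, oriented
by `J`. -/
def V (v : AdaptedCoframe s h η) (j : Fin (s + 1)) : Module.End ℝ (ExteriorAlgebra ℝ W) :=
  wedge (v.form 0 j * v.form 1 j)

/-- The operators `L j k` (`j ≠ k`) and `V j`. -/
def raisingOperators (v : AdaptedCoframe s h η) : Set (Module.End ℝ (ExteriorAlgebra ℝ W)) :=
  {T | (∃ j k, j ≠ k ∧ T = v.L j k) ∨ ∃ j, T = v.V j}

/-- The fibre of the bundle of real Lie algebras: the real Lie algebra of operators on real forms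
generated by the `L j k` (`j ≠ k`), the `V j`, and their adjoints for the metric. -/
def fibreAlgebra (v : AdaptedCoframe s h η) :
    LieSubalgebra ℝ (Module.End ℝ (ExteriorAlgebra ℝ W)) :=
  LieSubalgebra.lieSpan ℝ _ (v.raisingOperators ∪
    {T | ∃ S ∈ v.raisingOperators, LinearMap.IsAdjointPair (formMetric h) (formMetric h) S T})

/-- The space of complex forms of `J`-weight `i α`. -/
def weightSpace (v : AdaptedCoframe s h η) (α : ℤ) :
    Submodule ℂ (ℂ ⊗[ℝ] ExteriorAlgebra ℝ W) :=
  Module.End.eigenspace (v.J.baseChange ℂ) (Complex.I * α)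

/-- `w j = (v 0 j + i v 1 j) / √2`. -/
def w (v : AdaptedCoframe s h η) (j : Fin (s + 1)) : ℂ ⊗[ℝ] ExteriorAlgebra ℝ W :=
  ((1 / √2 : ℝ) : ℂ) • ((1 : ℂ) ⊗ₜ[ℝ] v.form 0 j + Complex.I ⊗ₜ[ℝ] v.form 1 j)

/-- The complex conjugate `(v 0 j - i v 1 j) / √2` of `w j`. -/
def wBar (v : AdaptedCoframe s h η) (j : Fin (s + 1)) : ℂ ⊗[ℝ] ExteriorAlgebra ℝ W :=
  ((1 / √2 : ℝ) : ℂ) • ((1 : ℂ) ⊗ₜ[ℝ] v.form 0 j - Complex.I ⊗ₜ[ℝ] v.form 1 j)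

/-- The forms `c`: the first `s + 1` are `w 0 ∧ ⋯ ∧ w s` with the factor `w r` omitted, the last
`s + 1` are `w 0 ∧ ⋯ ∧ w s` with `w r` replaced by `w r ∧ wBar r`. -/
def c (v : AdaptedCoframe s h η) :
    Fin (s + 1) ⊕ Fin (s + 1) → ℂ ⊗[ℝ] ExteriorAlgebra ℝ W
  | Sum.inl r => (List.ofFn fun j => if j = r then 1 else v.w j).prod
  | Sum.inr r => (List.ofFn fun j => if j = r then v.w j * v.wBar j else v.w j).prod

end AdaptedCoframe

end LinearAlgebra

/-! ### Pointwise `s`-Kähler manifolds of rank two -/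

section Manifold

variable {T : Type*} [AddCommGroup T] [Module ℝ T] [FiniteDimensional ℝ T]

/-- The metric on covectors induced by a metric `g` on vectors, through the musical isomorphism. -/
def dualMetric (g : LinearMap.BilinForm ℝ T) (hg : g.Nondegenerate) :
    LinearMap.BilinForm ℝ (Module.Dual ℝ T) :=
  g.compl₁₂ (g.toDual hg).symm.toLinearMap (g.toDual hg).symm.toLinearMap

variable {E : Type*} [NormedAddCommGroup E] [NormedSpace ℝ E] [FiniteDimensional ℝ E]
  {H : Type*} [TopologicalSpace H] (I : ModelWithCorners ℝ E H)
  (X : Type*) [TopologicalSpace X] [ChartedSpace H X] [IsManifold I ∞ X]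

instance (p : X) : FiniteDimensional ℝ (TangentSpace I p) :=
  inferInstanceAs (FiniteDimensional ℝ E)

/-- The cotangent space of `X` at `p`. -/
abbrev Cotangent {X : Type*} [TopologicalSpace X] [ChartedSpace H X] (p : X) : Type _ :=
  Module.Dual ℝ (TangentSpace I p)

/-- A Riemannian metric on `X`. -/
abbrev Metric : Type _ :=
  Bundle.ContMDiffRiemannianMetric I ∞ E (fun p : X => TangentSpace I p)

variable {I X}

/-- The scalar product of tangent vectors at `p`. -/
def tangentMetric (g : Metric I X) (p : X) : LinearMap.BilinForm ℝ (TangentSpace I p) :=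
  LinearMap.mk₂ ℝ (fun u v => g.inner p u v) (by simp) (by simp) (by simp) (by simp)

theorem tangentMetric_nondegenerate (g : Metric I X) (p : X) :
    (tangentMetric g p).Nondegenerate := by
  have key : ∀ u, tangentMetric g p u u = 0 → u = 0 := fun u hu => by
    by_contra h
    exact (g.pos p u h).ne' hu
  exact ⟨fun u hu => key u (hu u), fun u hu => key u (hu u)⟩

/-- The scalar product of covectors at `p`. -/
def cotangentMetric (g : Metric I X) (p : X) : LinearMap.BilinForm ℝ (Cotangent I p) :=
  dualMetric (tangentMetric g p) (tangentMetric_nondegenerate g p)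

variable (I X) in
/-- A pointwise `s`-Kähler structure of rank two (in the nondegenerate case
`dim X = 2 (s + 1)`): a Riemannian metric and two-forms `η j k`, `j, k = 0, …, s`, which admit an
adapted coframe at each point. Neither smoothness nor closedness of the forms is required, so that
`s`-Kähler and almost `s`-Kähler structures of rank two are special cases. -/
structure PointwiseSKahlerStructure (s : ℕ) where
  metric : Metric I X
  form : ∀ p : X, Fin (s + 1) → Fin (s + 1) → ⋀[ℝ]^2 (Cotangent I p)
  exists_coframe : ∀ p : X, Nonempty (AdaptedCoframe s (cotangentMetric metric p) (form p))

/-- The adapted coframes at `p` of a pointwise `s`-Kähler structure. -/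
abbrev PointwiseSKahlerStructure.Coframe {s : ℕ} (K : PointwiseSKahlerStructure I X s) (p : X) :
    Type _ :=
  AdaptedCoframe s (cotangentMetric K.metric p) (K.form p)

end Manifold

end SKahler

end

noncomputable section

namespace SKahler

section Exterior

variable {W : Type*} [AddCommGroup W] [Module ℝ W]

/-- Contraction of forms with a linear functional on covectors. -/
def contract (d : Module.Dual ℝ W) : Module.End ℝ (ExteriorAlgebra ℝ W) :=
  CliffordAlgebra.contractLeft (Q := (0 : QuadraticForm ℝ W)) d

theorem contract_ι_mul (d : Module.Dual ℝ W) (w : W) (x : ExteriorAlgebra ℝ W) :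
    contract d (ExteriorAlgebra.ι ℝ w * x) = d w • x - ExteriorAlgebra.ι ℝ w * contract d x :=
  CliffordAlgebra.contractLeft_ι_mul (Q := (0 : QuadraticForm ℝ W)) d w x

theorem contract_one (d : Module.Dual ℝ W) : contract d 1 = 0 :=
  CliffordAlgebra.contractLeft_one (Q := (0 : QuadraticForm ℝ W)) d

theorem contract_algebraMap (d : Module.Dual ℝ W) (r : ℝ) :
    contract d (algebraMap ℝ _ r) = 0 :=
  CliffordAlgebra.contractLeft_algebraMap (Q := (0 : QuadraticForm ℝ W)) d r

theorem contract_contract_add (d d' : Module.Dual ℝ W) (x : ExteriorAlgebra ℝ W) :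
    contract d (contract d' x) + contract d' (contract d x) = 0 := by
  have := CliffordAlgebra.contractLeft_comm (Q := (0 : QuadraticForm ℝ W)) (d := d) (d' := d') x
  exact eq_neg_iff_add_eq_zero.mp this

theorem contract_ιMulti (d : Module.Dual ℝ W) (n : ℕ) (b : Fin (n + 1) → W) :
    contract d (ExteriorAlgebra.ιMulti ℝ (n + 1) b) =
      ∑ j : Fin (n + 1), ((-1) ^ (j : ℕ) * d (b j)) •
        ExteriorAlgebra.ιMulti ℝ n (fun i => b (j.succAbove i)) := by
  induction n with
  | zero =>
    rw [ExteriorAlgebra.ιMulti_succ_apply, contract_ι_mul]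
    simp [contract_one]
  | succ n ih =>
    rw [ExteriorAlgebra.ιMulti_succ_apply, contract_ι_mul, Matrix.vecTail, ih, Finset.mul_sum,
      Fin.sum_univ_succ (n := n + 1), sub_eq_add_neg, ← Finset.sum_neg_distrib]
    congr 1
    · simp [Function.comp_def]
    · refine Finset.sum_congr rfl fun j _ => ?_
      rw [ExteriorAlgebra.ιMulti_succ_apply]
      simp [Matrix.vecTail, Function.comp_def, pow_succ]

theorem formMetric_ιMulti (h : LinearMap.BilinForm ℝ W) (n : ℕ) (a b : Fin n → W) :
    formMetric h (ExteriorAlgebra.ιMulti ℝ n a) (ExteriorAlgebra.ιMulti ℝ n b) =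
      (Matrix.of fun i j => h (a i) (b j)).det := by
  rw [← exteriorPower.ιMulti_apply_coe, ← exteriorPower.ιMulti_apply_coe, formMetric_apply,
    component_coe_self, powerMetric_ιMulti]

theorem formMetric_ιMulti_of_ne (h : LinearMap.BilinForm ℝ W) {m n : ℕ} (hmn : m ≠ n)
    (a : Fin m → W) (b : Fin n → W) :
    formMetric h (ExteriorAlgebra.ιMulti ℝ m a) (ExteriorAlgebra.ιMulti ℝ n b) = 0 := by
  rw [← exteriorPower.ιMulti_apply_coe, ← exteriorPower.ιMulti_apply_coe, formMetric_apply,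
    component_coe m n _ hmn, map_zero]

theorem ext_ιMulti {M : Type*} [AddCommGroup M] [Module ℝ M]
    {f g : ExteriorAlgebra ℝ W →ₗ[ℝ] M}
    (hfg : ∀ n (a : Fin n → W), f (ExteriorAlgebra.ιMulti ℝ n a) = g (ExteriorAlgebra.ιMulti ℝ n a)) :
    f = g :=
  LinearMap.ext_on_range (ExteriorAlgebra.ιMulti_span ℝ W) fun x => hfg x.1 x.2

theorem formMetric_ι_mul (h : LinearMap.BilinForm ℝ W) (w : W) (x y : ExteriorAlgebra ℝ W) :
    formMetric h (ExteriorAlgebra.ι ℝ w * x) y = formMetric h x (contract (h w) y) := by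
  have key : LinearMap.comp (formMetric h) (LinearMap.mulLeft ℝ (ExteriorAlgebra.ι ℝ w)) =
      LinearMap.compl₂ (formMetric h) (contract (h w)) := by
    refine ext_ιMulti fun m a => ext_ιMulti fun n b => ?_
    have hm : ExteriorAlgebra.ι ℝ w * ExteriorAlgebra.ιMulti ℝ m a =
        ExteriorAlgebra.ιMulti ℝ (m + 1) (Matrix.vecCons w a) := by
      rw [ExteriorAlgebra.ιMulti_succ_apply]; simp
    simp only [LinearMap.comp_apply, LinearMap.mulLeft_apply, LinearMap.compl₂_apply, hm]
    cases n with
    | zero =>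
      rw [formMetric_ιMulti_of_ne h (by simp), ExteriorAlgebra.ιMulti_zero_apply, contract_one,
        map_zero]
    | succ n =>
      rw [contract_ιMulti, map_sum]
      by_cases hmn : m = n
      · subst hmn
        rw [formMetric_ιMulti, Matrix.det_succ_row_zero]
        refine Finset.sum_congr rfl fun j _ => ?_
        rw [map_smul, formMetric_ιMulti]
        simp [Matrix.submatrix]
      · rw [formMetric_ιMulti_of_ne h (by simpa using hmn)]
        symm
        refine Finset.sum_eq_zero fun j _ => ?_
        rw [map_smul, formMetric_ιMulti_of_ne h hmn, smul_zero]
  exact LinearMap.congr_fun (LinearMap.congr_fun key x) y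

theorem formMetric_separatingRight {I : Type*} [Finite I] [DecidableEq I]
    (h : LinearMap.BilinForm ℝ W)
    (b : Module.Basis I ℝ W) (hb : ∀ i j, h (b i) (b j) = if i = j then 1 else 0)
    {y : ExteriorAlgebra ℝ W} (hy : ∀ x, formMetric h x y = 0) : y = 0 := by
  classical
  let : LinearOrder I := linearOrderOfSTO WellOrderingRel
  have hcoord : ∀ i, h (b i) = b.coord i := fun i => b.ext fun j => by
    simp [hb, Finsupp.single_apply, eq_comm]
  have hcomp : ∀ n, component n y = 0 := fun n => by
    refine (b.exteriorPower n).ext_elem fun t => ?_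
    rw [exteriorPower.basis_repr_apply, map_zero, Finsupp.zero_apply]
    have := hy (exteriorPower.ιMulti_family ℝ n b t : ⋀[ℝ]^n W)
    rw [formMetric_apply, powerMetric, LinearMap.comp_apply] at this
    rw [exteriorPower.ιMultiDual, ← this]
    congr 2
    simp [exteriorPower.ιMulti_family, Function.comp_def, hcoord]
  refine (DirectSum.decomposeLinearEquiv fun i => ⋀[ℝ]^i W).injective ?_
  rw [map_zero]
  exact DFinsupp.ext fun n => hcomp n

/-- Forms which are annihilated by all contractions are constant. -/
theorem mem_range_algebraMap_of_contract {I : Type*} [Finite I] [DecidableEq I]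
    (h : LinearMap.BilinForm ℝ W)
    (b : Module.Basis I ℝ W) (hb : ∀ i j, h (b i) (b j) = if i = j then 1 else 0)
    {y : ExteriorAlgebra ℝ W} (hy : ∀ i, contract (h (b i)) y = 0) :
    ∃ r : ℝ, y = algebraMap ℝ _ r := by
  have hy' : ∀ w, contract (h w) y = 0 := fun w => by
    have : ((CliffordAlgebra.contractLeft (Q := (0 : QuadraticForm ℝ W))).flip y).comp h = 0 :=
      b.ext fun i => hy i
    exact LinearMap.congr_fun this w
  have h1 : ∀ r : ℝ, formMetric h (algebraMap ℝ _ r) y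
      = formMetric h (algebraMap ℝ _ r) (algebraMap ℝ _ (formMetric h 1 y)) := fun r => by
    have h11 : formMetric h 1 1 = 1 := by
      have := formMetric_ιMulti h 0 ![] ![]
      simpa using this
    simp [Algebra.algebraMap_eq_smul_one, h11, mul_comm]
  refine ⟨formMetric h 1 y, sub_eq_zero.mp ?_⟩
  refine formMetric_separatingRight h b hb fun x => ?_
  induction x using CliffordAlgebra.left_induction with
  | algebraMap r => rw [map_sub, sub_eq_zero]; exact h1 r
  | add x x' hx hx' => rw [map_add, LinearMap.add_apply, hx, hx', add_zero]
  | ι_mul x m _ =>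
    have := formMetric_ι_mul h m x (y - algebraMap ℝ _ (formMetric h 1 y))
    rw [map_sub (contract (h m)), hy', contract_algebraMap, sub_zero, map_zero] at this
    exact this

theorem derivationExt_eq_sum {I : Type*} [Fintype I] (b : Module.Basis I ℝ W)
    (A : Module.End ℝ W) (x : ExteriorAlgebra ℝ W) :
    derivationExt A x = ∑ i, ExteriorAlgebra.ι ℝ (A (b i)) * contract (b.coord i) x := by
  induction x using CliffordAlgebra.left_induction with
  | algebraMap r =>
    have h1 : derivationExt A (1 : ExteriorAlgebra ℝ W) = 0 := by
      have := derivationExt_mul A 1 1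
      simpa using this
    have : derivationExt A (algebraMap ℝ _ r) = 0 := by
      rw [Algebra.algebraMap_eq_smul_one, map_smul, h1, smul_zero]
    rw [show (algebraMap ℝ (CliffordAlgebra (0 : QuadraticForm ℝ W)) r) =
      algebraMap ℝ (ExteriorAlgebra ℝ W) r from rfl, this]
    simp [contract_algebraMap]
  | add x y hx hy => simp only [map_add, mul_add, Finset.sum_add_distrib, hx, hy]
  | ι_mul x m hx =>
    change derivationExt A (ExteriorAlgebra.ι ℝ m * x) =
      ∑ i, ExteriorAlgebra.ι ℝ (A (b i)) * contract (b.coord i) (ExteriorAlgebra.ι ℝ m * x)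
    have hsw : ∀ i, ExteriorAlgebra.ι ℝ (A (b i)) * contract (b.coord i) (ExteriorAlgebra.ι ℝ m * x)
        = ExteriorAlgebra.ι ℝ (A (b.coord i m • b i)) * x
          + ExteriorAlgebra.ι ℝ m * (ExteriorAlgebra.ι ℝ (A (b i)) * contract (b.coord i) x) := by
      intro i
      rw [contract_ι_mul, mul_sub, ← mul_assoc, ← mul_assoc,
        eq_neg_of_add_eq_zero_left (ExteriorAlgebra.ι_add_mul_swap (A (b i)) m)]
      simp
    rw [derivationExt_mul, derivationExt_ι, hx]
    simp only [hsw, Finset.sum_add_distrib, ← Finset.mul_sum, ← Finset.sum_mul, ← map_sum]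
    congr 4
    exact (b.sum_repr m).symm

end Exterior

section Complexification

variable {M : Type*} [AddCommGroup M] [Module ℝ M]

/-- The real part of an element of a complexified real vector space. -/
def rePart : ℂ ⊗[ℝ] M →ₗ[ℝ] M :=
  (TensorProduct.lid ℝ M).toLinearMap ∘ₗ Complex.reLm.rTensor M

/-- The imaginary part of an element of a complexified real vector space. -/
def imPart : ℂ ⊗[ℝ] M →ₗ[ℝ] M :=
  (TensorProduct.lid ℝ M).toLinearMap ∘ₗ Complex.imLm.rTensor M

theorem rePart_tmul (z : ℂ) (x : M) : rePart (z ⊗ₜ[ℝ] x) = z.re • x := by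
  simp [rePart]

theorem imPart_tmul (z : ℂ) (x : M) : imPart (z ⊗ₜ[ℝ] x) = z.im • x := by
  simp [imPart]

theorem rePart_add_imPart (z : ℂ ⊗[ℝ] M) :
    (1 : ℂ) ⊗ₜ[ℝ] rePart z + Complex.I ⊗ₜ[ℝ] imPart z = z := by
  induction z with
  | zero => simp
  | add x y hx hy =>
    rw [map_add, map_add, TensorProduct.tmul_add, TensorProduct.tmul_add]
    conv_rhs => rw [← hx, ← hy]
    abel
  | tmul c x =>
    rw [rePart_tmul, imPart_tmul, ← TensorProduct.smul_tmul, ← TensorProduct.smul_tmul,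
      ← TensorProduct.add_tmul]
    congr 1
    apply Complex.ext <;> simp

theorem rePart_baseChange (T : Module.End ℝ M) (z : ℂ ⊗[ℝ] M) :
    rePart (T.baseChange ℂ z) = T (rePart z) := by
  induction z with
  | zero => simp
  | add x y hx hy => simp only [map_add, hx, hy]
  | tmul c x => simp [rePart_tmul]

theorem imPart_baseChange (T : Module.End ℝ M) (z : ℂ ⊗[ℝ] M) :
    imPart (T.baseChange ℂ z) = T (imPart z) := by
  induction z with
  | zero => simp
  | add x y hx hy => simp only [map_add, hx, hy]
  | tmul c x => simp [imPart_tmul]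

theorem baseChange_injective :
    Function.Injective (fun T : Module.End ℝ M => T.baseChange ℂ) := fun S T hST => by
  ext x
  have := congrArg rePart (LinearMap.congr_fun hST ((1 : ℂ) ⊗ₜ[ℝ] x))
  simpa [rePart_tmul] using this

end Complexification

section CAR

/-- The canonical anticommutation relations between creation operators `χ` and annihilation
operators `χ'`. -/
structure IsCAR {ι R : Type*} [DecidableEq ι] [Ring R] (χ χ' : ι → R) : Prop where
  create : ∀ a b, χ a * χ b + χ b * χ a = 0
  annihilate : ∀ a b, χ' a * χ' b + χ' b * χ' a = 0
  mixed : ∀ a b, χ' a * χ b + χ b * χ' a = if a = b then 1 else 0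

end CAR

namespace AdaptedCoframe

variable {W : Type*} [AddCommGroup W] [Module ℝ W] {s : ℕ} {h : LinearMap.BilinForm ℝ W}
  {η : Fin (s + 1) → Fin (s + 1) → ⋀[ℝ]^2 W} (v : AdaptedCoframe s h η)

/-- Wedge product with a covector of the coframe, on complex forms. -/
def wedgeC (a : Fin 2 × Fin (s + 1)) : Module.End ℂ (ℂ ⊗[ℝ] ExteriorAlgebra ℝ W) :=
  (wedge (ExteriorAlgebra.ι ℝ (v.basis a))).baseChange ℂ

/-- Contraction with a covector of the coframe, on complex forms. -/
def contractC (a : Fin 2 × Fin (s + 1)) : Module.End ℂ (ℂ ⊗[ℝ] ExteriorAlgebra ℝ W) :=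
  (contract (h (v.basis a))).baseChange ℂ

theorem isCAR_wedgeC : IsCAR v.wedgeC v.contractC where
  create a b := by
    rw [wedgeC, wedgeC, ← LinearMap.baseChange_mul, ← LinearMap.baseChange_mul,
      ← LinearMap.baseChange_add]
    convert LinearMap.baseChange_zero
    refine LinearMap.ext fun x => ?_
    simp only [wedge, LinearMap.add_apply, Module.End.mul_apply, LinearMap.mulLeft_apply,
      ← mul_assoc, ← add_mul, ExteriorAlgebra.ι_add_mul_swap, zero_mul, LinearMap.zero_apply]
  annihilate a b := by
    rw [contractC, contractC, ← LinearMap.baseChange_mul, ← LinearMap.baseChange_mul,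
      ← LinearMap.baseChange_add]
    convert LinearMap.baseChange_zero
    refine LinearMap.ext fun x => ?_
    exact contract_contract_add _ _ x
  mixed a b := by
    rw [contractC, wedgeC, ← LinearMap.baseChange_mul, ← LinearMap.baseChange_mul,
      ← LinearMap.baseChange_add]
    have : contract (h (v.basis a)) * wedge (ExteriorAlgebra.ι ℝ (v.basis b)) +
        wedge (ExteriorAlgebra.ι ℝ (v.basis b)) * contract (h (v.basis a)) =
        if a = b then 1 else 0 := by
      refine LinearMap.ext fun x => ?_
      simp only [wedge, LinearMap.add_apply, Module.End.mul_apply, LinearMap.mulLeft_apply,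
        contract_ι_mul, sub_add_cancel, v.orthonormal]
      split_ifs <;> simp
    rw [this]
    split_ifs
    · exact LinearMap.baseChange_one _ _
    · exact LinearMap.baseChange_zero

theorem contractC_one (a : Fin 2 × Fin (s + 1)) : v.contractC a 1 = 0 := by
  rw [contractC, Algebra.TensorProduct.one_def, LinearMap.baseChange_tmul, contract_one,
    TensorProduct.tmul_zero]

theorem eq_smul_one_of_contractC {z : ℂ ⊗[ℝ] ExteriorAlgebra ℝ W}
    (hz : ∀ a, v.contractC a z = 0) : ∃ c : ℂ, z = c • 1 := by
  obtain ⟨x, hx⟩ := mem_range_algebraMap_of_contract h v.basis v.orthonormal (y := rePart z)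
    fun a => by rw [← rePart_baseChange]; exact (congrArg rePart (hz a)).trans (map_zero _)
  obtain ⟨y, hy⟩ := mem_range_algebraMap_of_contract h v.basis v.orthonormal (y := imPart z)
    fun a => by rw [← imPart_baseChange]; exact (congrArg imPart (hz a)).trans (map_zero _)
  refine ⟨x + y * Complex.I, ?_⟩
  rw [← rePart_add_imPart z, hx, hy, Algebra.algebraMap_eq_smul_one,
    Algebra.algebraMap_eq_smul_one, ← TensorProduct.smul_tmul, ← TensorProduct.smul_tmul,
    ← TensorProduct.add_tmul, Algebra.TensorProduct.one_def, TensorProduct.smul_tmul']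
  congr 1
  apply Complex.ext <;> simp

/-- For `ε = 1` the wedge product with `w j`, for `ε = -1` that with `wBar j`. -/
def create (ε : ℂ) (j : Fin (s + 1)) : Module.End ℂ (ℂ ⊗[ℝ] ExteriorAlgebra ℝ W) :=
  ((1 / √2 : ℝ) : ℂ) • (v.wedgeC (0, j) + (ε * Complex.I) • v.wedgeC (1, j))

/-- The contractions dual to the operators `create`. -/
def annihilate (ε : ℂ) (j : Fin (s + 1)) : Module.End ℂ (ℂ ⊗[ℝ] ExteriorAlgebra ℝ W) :=
  ((1 / √2 : ℝ) : ℂ) • (v.contractC (0, j) - (ε * Complex.I) • v.contractC (1, j))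

theorem one_div_sqrt_two_mul_self : ((1 / √2 : ℝ) : ℂ) * ((1 / √2 : ℝ) : ℂ) = 1 / 2 := by
  rw [← Complex.ofReal_mul]
  have : (1 / √2 : ℝ) * (1 / √2 : ℝ) = 1 / 2 := by
    rw [div_mul_div_comm, Real.mul_self_sqrt (by norm_num)]; norm_num
  rw [this]; norm_num

theorem wedgeC_apply (a : Fin 2 × Fin (s + 1)) (z : ℂ ⊗[ℝ] ExteriorAlgebra ℝ W) :
    v.wedgeC a z = ((1 : ℂ) ⊗ₜ[ℝ] ExteriorAlgebra.ι ℝ (v.basis a)) * z := by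
  induction z with
  | zero => simp
  | add x y hx hy => rw [map_add, hx, hy, mul_add]
  | tmul c x => simp [wedgeC, wedge]

theorem w_mul (j : Fin (s + 1)) (z : ℂ ⊗[ℝ] ExteriorAlgebra ℝ W) :
    v.w j * z = v.create 1 j z := by
  have : Complex.I ⊗ₜ[ℝ] v.form 1 j = Complex.I • ((1 : ℂ) ⊗ₜ[ℝ] v.form 1 j) := by
    rw [TensorProduct.smul_tmul', smul_eq_mul, mul_one]
  rw [w, this]
  simp only [create, LinearMap.smul_apply, LinearMap.add_apply, wedgeC_apply, form,
    smul_mul_assoc, add_mul, one_mul]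

theorem wBar_mul (j : Fin (s + 1)) (z : ℂ ⊗[ℝ] ExteriorAlgebra ℝ W) :
    v.wBar j * z = v.create (-1) j z := by
  have : Complex.I ⊗ₜ[ℝ] v.form 1 j = Complex.I • ((1 : ℂ) ⊗ₜ[ℝ] v.form 1 j) := by
    rw [TensorProduct.smul_tmul', smul_eq_mul, mul_one]
  rw [wBar, this, sub_eq_add_neg, ← neg_smul]
  simp only [create, LinearMap.smul_apply, LinearMap.add_apply, wedgeC_apply, form,
    smul_mul_assoc, neg_one_mul, add_mul]

theorem annihilate_one (ε : ℂ) (j : Fin (s + 1)) : v.annihilate ε j 1 = 0 := by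
  simp [annihilate, contractC_one]

theorem create_mul_create (ε ε' : ℂ) (j k : Fin (s + 1)) :
    v.create ε j * v.create ε' k = (1 / 2 : ℂ) • (v.wedgeC (0, j) * v.wedgeC (0, k) -
      (ε * ε') • (v.wedgeC (1, j) * v.wedgeC (1, k)) + Complex.I •
        (ε' • (v.wedgeC (0, j) * v.wedgeC (1, k)) + ε • (v.wedgeC (1, j) * v.wedgeC (0, k)))) := by
  have hI : ε * Complex.I * (ε' * Complex.I) = -(ε * ε') := by
    linear_combination ε * ε' * Complex.I_mul_I
  simp only [create, smul_mul_smul_comm, one_div_sqrt_two_mul_self, mul_add, add_mul, hI]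
  simp only [smul_mul_assoc, mul_smul_comm]
  module

theorem annihilate_mul_annihilate (ε ε' : ℂ) (j k : Fin (s + 1)) :
    v.annihilate ε j * v.annihilate ε' k =
      (1 / 2 : ℂ) • (v.contractC (0, j) * v.contractC (0, k) -
      (ε * ε') • (v.contractC (1, j) * v.contractC (1, k)) - Complex.I •
        (ε' • (v.contractC (0, j) * v.contractC (1, k)) +
          ε • (v.contractC (1, j) * v.contractC (0, k)))) := by
  have hI : ε * Complex.I * (ε' * Complex.I) = -(ε * ε') := by
    linear_combination ε * ε' * Complex.I_mul_I
  simp only [annihilate, smul_mul_smul_comm, one_div_sqrt_two_mul_self, mul_sub, sub_mul, hI]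
  simp only [smul_mul_assoc, mul_smul_comm]
  module

theorem annihilate_mul_create (ε ε' : ℂ) (j k : Fin (s + 1)) :
    v.annihilate ε j * v.create ε' k = (1 / 2 : ℂ) • (v.contractC (0, j) * v.wedgeC (0, k) +
      (ε * ε') • (v.contractC (1, j) * v.wedgeC (1, k)) + Complex.I •
        (ε' • (v.contractC (0, j) * v.wedgeC (1, k)) -
          ε • (v.contractC (1, j) * v.wedgeC (0, k)))) := by
  have hI : ε * Complex.I * (ε' * Complex.I) = -(ε * ε') := by
    linear_combination ε * ε' * Complex.I_mul_I
  simp only [create, annihilate, smul_mul_smul_comm, one_div_sqrt_two_mul_self, mul_add, sub_mul, hI]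
  simp only [smul_mul_assoc, mul_smul_comm]
  module

theorem create_mul_annihilate (ε ε' : ℂ) (j k : Fin (s + 1)) :
    v.create ε j * v.annihilate ε' k = (1 / 2 : ℂ) • (v.wedgeC (0, j) * v.contractC (0, k) +
      (ε * ε') • (v.wedgeC (1, j) * v.contractC (1, k)) + Complex.I •
        (ε • (v.wedgeC (1, j) * v.contractC (0, k)) -
          ε' • (v.wedgeC (0, j) * v.contractC (1, k)))) := by
  have hI : ε * Complex.I * (ε' * Complex.I) = -(ε * ε') := by
    linear_combination ε * ε' * Complex.I_mul_I
  simp only [create, annihilate, smul_mul_smul_comm, one_div_sqrt_two_mul_self, mul_sub, add_mul, hI]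
  simp only [smul_mul_assoc, mul_smul_comm]
  module

theorem create_anticomm (ε ε' : ℂ) (j k : Fin (s + 1)) :
    v.create ε j * v.create ε' k + v.create ε' k * v.create ε j = 0 := by
  have H := v.isCAR_wedgeC.create
  rw [create_mul_create, create_mul_create]
  linear_combination (norm := module) (1 / 2 : ℂ) • H (0, j) (0, k)
    - ((1 / 2 : ℂ) * (ε * ε')) • H (1, j) (1, k)
    + ((1 / 2 : ℂ) * Complex.I * ε') • H (0, j) (1, k)
    + ((1 / 2 : ℂ) * Complex.I * ε) • H (1, j) (0, k)

theorem annihilate_anticomm (ε ε' : ℂ) (j k : Fin (s + 1)) :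
    v.annihilate ε j * v.annihilate ε' k + v.annihilate ε' k * v.annihilate ε j = 0 := by
  have H := v.isCAR_wedgeC.annihilate
  rw [annihilate_mul_annihilate, annihilate_mul_annihilate]
  linear_combination (norm := module) (1 / 2 : ℂ) • H (0, j) (0, k)
    - ((1 / 2 : ℂ) * (ε * ε')) • H (1, j) (1, k)
    - ((1 / 2 : ℂ) * Complex.I * ε') • H (0, j) (1, k)
    - ((1 / 2 : ℂ) * Complex.I * ε) • H (1, j) (0, k)

theorem annihilate_create (ε ε' : ℂ) (j k : Fin (s + 1)) :
    v.annihilate ε j * v.create ε' k + v.create ε' k * v.annihilate ε j =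
      ((1 + ε * ε') / 2) • (if j = k then 1 else 0) := by
  have H := v.isCAR_wedgeC.mixed
  have H00 := H (0, j) (0, k)
  have H11 := H (1, j) (1, k)
  have H01 := H (0, j) (1, k)
  have H10 := H (1, j) (0, k)
  simp only [Prod.mk.injEq, true_and, zero_ne_one, one_ne_zero, false_and, if_false] at H00 H11 H01 H10
  rw [annihilate_mul_create, create_mul_annihilate]
  linear_combination (norm := module) (1 / 2 : ℂ) • H00
    + ((1 / 2 : ℂ) * (ε * ε')) • H11
    + ((1 / 2 : ℂ) * Complex.I * ε') • H01
    - ((1 / 2 : ℂ) * Complex.I * ε) • H10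

/-- The operators which create a hole in the form `w 0 ∧ ⋯ ∧ w s`, up to sign the contraction
with `w j` and the wedge product with `wBar j`. -/
def hole : Fin (s + 1) ⊕ Fin (s + 1) → Module.End ℂ (ℂ ⊗[ℝ] ExteriorAlgebra ℝ W)
  | Sum.inl j => ((-1) ^ (j : ℕ) : ℂ) • v.annihilate 1 j
  | Sum.inr j => (-(-1) ^ (j : ℕ) : ℂ) • v.create (-1) j

/-- The operators dual to the operators `hole`. -/
def fill : Fin (s + 1) ⊕ Fin (s + 1) → Module.End ℂ (ℂ ⊗[ℝ] ExteriorAlgebra ℝ W)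
  | Sum.inl j => ((-1) ^ (j : ℕ) : ℂ) • v.create 1 j
  | Sum.inr j => (-(-1) ^ (j : ℕ) : ℂ) • v.annihilate (-1) j

theorem isCAR_hole : IsCAR v.hole v.fill where
  create a b := by
    rcases a with j | j <;> rcases b with k | k <;>
    simp only [hole, smul_mul_smul_comm]
    · linear_combination (norm := module) ((-1) ^ (j : ℕ) * (-1) ^ (k : ℕ) : ℂ) • v.annihilate_anticomm 1 1 j k
    · linear_combination (norm := module) (-(-1) ^ (j : ℕ) * (-1) ^ (k : ℕ) : ℂ) • v.annihilate_create 1 (-1) j k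
    · linear_combination (norm := module) (-(-1) ^ (j : ℕ) * (-1) ^ (k : ℕ) : ℂ) • v.annihilate_create 1 (-1) k j
    · linear_combination (norm := module) ((-1) ^ (j : ℕ) * (-1) ^ (k : ℕ) : ℂ) • v.create_anticomm (-1) (-1) j k
  annihilate a b := by
    rcases a with j | j <;> rcases b with k | k <;>
    simp only [fill, smul_mul_smul_comm]
    · linear_combination (norm := module) ((-1) ^ (j : ℕ) * (-1) ^ (k : ℕ) : ℂ) • v.create_anticomm 1 1 j k
    · linear_combination (norm := module) (-(-1) ^ (j : ℕ) * (-1) ^ (k : ℕ) : ℂ) • v.annihilate_create (-1) 1 k j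
    · linear_combination (norm := module) (-(-1) ^ (j : ℕ) * (-1) ^ (k : ℕ) : ℂ) • v.annihilate_create (-1) 1 j k
    · linear_combination (norm := module) ((-1) ^ (j : ℕ) * (-1) ^ (k : ℕ) : ℂ) • v.annihilate_anticomm (-1) (-1) j k
  mixed a b := by
    have hsq : ∀ j : Fin (s + 1), ((-1) ^ (j : ℕ) * (-1) ^ (j : ℕ) : ℂ) = 1 := fun j => by
      rw [← mul_pow]; simp
    rcases a with j | j <;> rcases b with k | k <;>
    simp only [fill, hole, smul_mul_smul_comm, Sum.inl.injEq, Sum.inr.injEq, reduceCtorEq, if_false]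
    · have := v.annihilate_create 1 1 k j
      rw [add_comm] at this
      rw [mul_comm ((-1 : ℂ) ^ (k : ℕ)), ← smul_add, this]
      by_cases hjk : j = k
      · subst hjk; simp [hsq]
      · simp [hjk, Ne.symm hjk]
    · linear_combination (norm := module) (-(-1) ^ (j : ℕ) * (-1) ^ (k : ℕ) : ℂ) • v.create_anticomm 1 (-1) j k
    · linear_combination (norm := module) (-(-1) ^ (j : ℕ) * (-1) ^ (k : ℕ) : ℂ) • v.annihilate_anticomm (-1) 1 j k
    · have := v.annihilate_create (-1) (-1) j k
      rw [mul_comm (-(-1 : ℂ) ^ (k : ℕ)), ← smul_add, this]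
      by_cases hjk : j = k
      · subst hjk; simp [hsq]
      · simp [hjk]

end AdaptedCoframe

section Products

variable {A : Type*} [Ring A] [Algebra ℂ A]

theorem mul_prod_ofFn (x : A) (κ : ℂ) : ∀ (n : ℕ) (f g : Fin n → A) (r : Fin n)
    (_ : ∀ j, j ≠ r → g j = f j) (_ : ∀ j, j ≠ r → x * f j = -(f j * x))
    (_ : x * f r = κ • g r),
    x * (List.ofFn f).prod = ((-1) ^ (r : ℕ) * κ) • (List.ofFn g).prod
  | 0, _, _, r, _, _, _ => r.elim0
  | n + 1, f, g, r, hg, hx, hr => by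
    rw [List.ofFn_succ, List.ofFn_succ, List.prod_cons, List.prod_cons]
    induction r using Fin.cases with
    | zero =>
      have : (fun i : Fin n => g i.succ) = fun i => f i.succ :=
        funext fun i => hg _ (Fin.succ_ne_zero i)
      rw [← mul_assoc, hr, this]
      simp
    | succ r =>
      have ih := mul_prod_ofFn x κ n (fun i => f i.succ) (fun i => g i.succ) r
        (fun j hj => hg _ (by simpa using hj)) (fun j hj => hx _ (by simpa using hj)) hr
      rw [← mul_assoc, hx 0 (Fin.succ_ne_zero r).symm, neg_mul, mul_assoc, ih,
        hg 0 (Fin.succ_ne_zero r).symm, mul_smul_comm, ← neg_smul, Fin.val_succ, pow_succ]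
      congr 1
      ring

theorem map_prod_ofFn_eq_zero (F : A →ₗ[ℂ] A) (h1 : F 1 = 0) : ∀ (n : ℕ) (f : Fin n → A)
    (_ : ∀ j z, F (f j * z) = -(f j * F z)), F (List.ofFn f).prod = 0
  | 0, _, _ => by simpa using h1
  | n + 1, f, hF => by
    rw [List.ofFn_succ, List.prod_cons, hF,
      map_prod_ofFn_eq_zero F h1 n _ fun j => hF j.succ, mul_zero, neg_zero]

theorem map_prod_ofFn (F : A →ₗ[ℂ] A) (h1 : F 1 = 0) : ∀ (n : ℕ) (f : Fin n → A) (r : Fin n)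
    (_ : ∀ j, j ≠ r → ∀ z, F (f j * z) = -(f j * F z))
    (_ : ∀ z, F (f r * z) = z - f r * F z),
    F (List.ofFn f).prod =
      ((-1) ^ (r : ℕ) : ℂ) • (List.ofFn fun j => if j = r then 1 else f j).prod
  | 0, _, r, _, _ => r.elim0
  | n + 1, f, r, hF, hr => by
    rw [List.ofFn_succ, List.ofFn_succ, List.prod_cons, List.prod_cons]
    induction r using Fin.cases with
    | zero =>
      rw [hr, map_prod_ofFn_eq_zero F h1 n _ fun j => hF j.succ (Fin.succ_ne_zero j)]
      simp
    | succ r =>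
      have ih := map_prod_ofFn F h1 n (fun i => f i.succ) r
        (fun j hj => hF _ (by simpa using hj)) hr
      rw [hF 0 (Fin.succ_ne_zero r).symm, ih, if_neg (Fin.succ_ne_zero r).symm, mul_smul_comm,
        ← neg_smul, Fin.val_succ, pow_succ]
      simp

theorem prod_ofFn_ne_zero [Nontrivial A] : ∀ (n : ℕ) (f : Fin n → A) (F : Fin n → A →ₗ[ℂ] A)
    (_ : ∀ j, F j 1 = 0) (_ : ∀ j k, j ≠ k → ∀ z, F j (f k * z) = -(f k * F j z))
    (_ : ∀ j z, F j (f j * z) = z - f j * F j z), (List.ofFn f).prod ≠ 0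
  | 0, _, _, _, _, _ => by simp
  | n + 1, f, F, h1, hne, heq => fun h0 => by
    have key : F 0 (List.ofFn f).prod = (List.ofFn fun i : Fin n => f i.succ).prod := by
      rw [List.ofFn_succ, List.prod_cons, heq, map_prod_ofFn_eq_zero (F 0) (h1 0) n _
        fun j => hne 0 j.succ (Fin.succ_ne_zero j).symm, mul_zero, sub_zero]
    rw [h0, map_zero] at key
    exact prod_ofFn_ne_zero n (fun i => f i.succ) (fun i => F i.succ) (fun j => h1 _)
      (fun j k hjk => hne _ _ (by simpa using hjk)) (fun j => heq _) key.symm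

theorem exists_eq_prod_ofFn_mul : ∀ (n : ℕ) (f : Fin n → A) (F : Fin n → A →ₗ[ℂ] A)
    (_ : ∀ j k, j ≠ k → ∀ z, F j (f k * z) = -(f k * F j z))
    (_ : ∀ j z, F j (f j * z) = z - f j * F j z)
    (_ : ∀ j k z, F j (F k z) = -F k (F j z)) (_ : ∀ j z, F j (F j z) = 0)
    (y : A) (_ : ∀ j, f j * y = 0),
    ∃ z, y = (List.ofFn f).prod * z ∧ (∀ j, F j z = 0) ∧
      ∀ G : A →ₗ[ℂ] A, G y = 0 → (∀ j z, G (F j z) = -F j (G z)) → G z = 0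
  | 0, _, _, _, _, _, _, y, _ => ⟨y, by simp, fun j => j.elim0, fun _ hG _ => hG⟩
  | n + 1, f, F, hne, heq, hF, hF0, y, hy => by
    have hy0 : y = f 0 * F 0 y := by
      have := heq 0 y
      rw [hy, map_zero] at this
      exact sub_eq_zero.mp this.symm
    obtain ⟨z, hz, hFz, hG⟩ := exists_eq_prod_ofFn_mul n (fun i => f i.succ) (fun i => F i.succ)
      (fun j k hjk => hne _ _ (by simpa using hjk)) (fun j => heq _) (fun j k => hF _ _)
      (fun j => hF0 _) (F 0 y) fun j => by
        have := hne 0 j.succ (Fin.succ_ne_zero j).symm y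
        rw [hy, map_zero] at this
        exact neg_eq_zero.mp this.symm
    refine ⟨z, ?_, ?_, fun G hGy hGF => hG G ?_ fun j => hGF _⟩
    · rw [List.ofFn_succ, List.prod_cons, mul_assoc, ← hz, ← hy0]
    · intro j
      induction j using Fin.cases with
      | zero => exact hG (F 0) (hF0 0 y) fun j => hF _ _
      | succ j => exact hFz j
    · rw [hGF, hGy, map_zero, neg_zero]

end Products

section Fock

variable {ι V : Type*} [Fintype ι] [DecidableEq ι] [AddCommGroup V] [Module ℂ V]

/-- The second quantization of a matrix. -/
def quantize (χ χ' : ι → Module.End ℂ V) : Matrix ι ι ℂ →ₗ[ℂ] Module.End ℂ V where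
  toFun M := ∑ a, ∑ b, M a b • (χ a * χ' b)
  map_add' M N := by simp [add_smul, Finset.sum_add_distrib]
  map_smul' c M := by simp [Finset.smul_sum, smul_smul]

omit [DecidableEq ι] in
theorem quantize_apply (χ χ' : ι → Module.End ℂ V) (M : Matrix ι ι ℂ) :
    quantize χ χ' M = ∑ a, ∑ b, M a b • (χ a * χ' b) := rfl

theorem quantize_single (χ χ' : ι → Module.End ℂ V) (a b : ι) (m : ℂ) :
    quantize χ χ' (Matrix.single a b m) = m • (χ a * χ' b) := by
  rw [quantize_apply, Finset.sum_eq_single a, Finset.sum_eq_single b]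
  · simp
  · intro c _ hc; simp [Ne.symm hc]
  · simp
  · intro c _ hc; simp [Ne.symm hc]
  · simp

theorem quantize_one (χ χ' : ι → Module.End ℂ V) :
    quantize χ χ' 1 = ∑ a, χ a * χ' a := by
  simp [quantize_apply, Matrix.one_apply]

namespace IsCAR

variable {χ χ' : ι → Module.End ℂ V} (H : IsCAR χ χ')

include H

omit [Fintype ι] in
theorem annihilate_self (a : ι) : χ' a * χ' a = 0 := by
  have := H.annihilate a a
  rw [← two_nsmul] at this
  exact (smul_eq_zero.mp (show (2 : ℂ) • (χ' a * χ' a) = 0 by rw [← this]; module)).resolve_left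
    two_ne_zero

omit [Fintype ι] in
theorem quadratic_comm (a b c d : ι) :
    χ a * χ' b * (χ c * χ' d) - χ c * χ' d * (χ a * χ' b) =
      (if b = c then χ a * χ' d else 0) - if d = a then χ c * χ' b else 0 := by
  have h1 : χ a * χ' b * (χ c * χ' d) =
      (if b = c then χ a * χ' d else 0) - χ a * χ c * (χ' b * χ' d) := by
    have := eq_sub_of_add_eq (H.mixed b c)
    rw [mul_assoc, ← mul_assoc (χ' b), this]
    split_ifs <;> noncomm_ring
  have h2 : χ c * χ' d * (χ a * χ' b) =
      (if d = a then χ c * χ' b else 0) - χ c * χ a * (χ' d * χ' b) := by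
    have := eq_sub_of_add_eq (H.mixed d a)
    rw [mul_assoc, ← mul_assoc (χ' d), this]
    split_ifs <;> noncomm_ring
  rw [h1, h2, eq_neg_of_add_eq_zero_left (H.create a c),
    eq_neg_of_add_eq_zero_left (H.annihilate b d), neg_mul_neg]
  abel

theorem quantize_lie (M N : Matrix ι ι ℂ) :
    quantize χ χ' (M * N - N * M) =
      quantize χ χ' M * quantize χ χ' N - quantize χ χ' N * quantize χ χ' M := by
  induction M using Matrix.induction_on' with
  | h_zero => simp
  | h_add M M' hM hM' =>
    rw [add_mul, mul_add, add_sub_add_comm, map_add, hM, hM', map_add, add_mul, mul_add,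
      add_sub_add_comm]
  | h_std_basis a b m =>
    induction N using Matrix.induction_on' with
    | h_zero => simp
    | h_add N N' hN hN' =>
      rw [add_mul, mul_add, add_sub_add_comm, map_add, hN, hN', map_add, add_mul, mul_add,
        add_sub_add_comm]
    | h_std_basis c d n =>
      have key := H.quadratic_comm a b c d
      simp only [quantize_single, smul_mul_smul_comm, map_sub]
      rw [mul_comm n m, ← smul_sub, key, smul_sub]
      congr 1
      · by_cases hbc : b = c
        · subst hbc; rw [Matrix.single_mul_single_same, quantize_single, if_pos rfl]
        · rw [Matrix.single_mul_single_of_ne _ _ _ _ hbc, map_zero, if_neg hbc, smul_zero]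
      · by_cases hda : d = a
        · subst hda; rw [Matrix.single_mul_single_same, quantize_single, if_pos rfl, mul_comm]
        · rw [Matrix.single_mul_single_of_ne _ _ _ _ hda, map_zero, if_neg hda, smul_zero]

variable {Ω : V} (hΩ : ∀ a, χ' a Ω = 0)

omit [Fintype ι] in
include hΩ in
theorem annihilate_create_vacuum (a b : ι) : χ' a (χ b Ω) = if a = b then Ω else 0 := by
  have := LinearMap.congr_fun (H.mixed a b) Ω
  simp only [LinearMap.add_apply, Module.End.mul_apply, hΩ, map_zero, add_zero] at this
  rw [this]
  split_ifs <;> rfl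

include hΩ in
theorem quantize_create_vacuum (M : Matrix ι ι ℂ) (c : ι) :
    quantize χ χ' M (χ c Ω) = ∑ a, M a c • χ a Ω := by
  simp [quantize_apply, LinearMap.sum_apply, H.annihilate_create_vacuum hΩ,
    apply_ite (χ _), smul_ite]

include hΩ in
theorem linearIndependent_create_vacuum (h0 : Ω ≠ 0) : LinearIndependent ℂ fun a => χ a Ω := by
  rw [Fintype.linearIndependent_iff]
  intro g hg a
  have := congrArg (χ' a) hg
  simp only [map_sum, map_smul, H.annihilate_create_vacuum hΩ, map_zero, smul_ite, smul_zero,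
    Finset.sum_ite_eq, Finset.mem_univ, if_true] at this
  exact (smul_eq_zero.mp this).resolve_right h0

omit [Fintype ι] in
theorem annihilate_eq_zero_of_sum (S : Finset ι) : ∀ (m : ℕ) (y : V),
    ∑ a ∈ S, χ a (χ' a y) + m • y = 0 → ∀ a ∈ S, χ' a y = 0 := by
  induction S using Finset.induction_on with
  | empty => simp
  | insert a S ha ih =>
    intro m y hy
    have haa : χ' a (χ' a y) = 0 := LinearMap.congr_fun (H.annihilate_self a) y
    have hz : ∑ b ∈ S, χ b (χ' b (χ' a y)) + (m + 1) • χ' a y = 0 := by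
      have hb : ∀ b ∈ S, χ' a (χ b (χ' b y)) = χ b (χ' b (χ' a y)) := fun b hb => by
        have h1 := LinearMap.congr_fun (H.mixed a b) (χ' b y)
        have h2 := LinearMap.congr_fun (H.annihilate a b) y
        rw [if_neg (fun h : a = b => ha (h ▸ hb))] at h1
        simp only [LinearMap.add_apply, Module.End.mul_apply, LinearMap.zero_apply] at h1 h2
        rw [eq_neg_of_add_eq_zero_left h1, eq_neg_of_add_eq_zero_left h2, map_neg, neg_neg]
      have hab : χ' a (χ a (χ' a y)) = χ' a y := by
        have h1 := LinearMap.congr_fun (H.mixed a a) (χ' a y)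
        simpa only [if_true, LinearMap.add_apply, Module.End.mul_apply, haa, map_zero, add_zero,
          Module.End.one_apply] using h1
      have := congrArg (χ' a) hy
      rw [Finset.sum_insert ha, map_add, map_add, map_sum, Finset.sum_congr rfl hb, hab, map_nsmul,
        map_zero] at this
      rw [← this, add_smul, one_smul]
      abel
    have hza : χ' a y = 0 := by
      have h0 := ih (m + 1) _ hz
      rw [Finset.sum_eq_zero fun b hb => by rw [h0 b hb, map_zero], zero_add,
        ← Nat.cast_smul_eq_nsmul ℂ] at hz
      exact (smul_eq_zero.mp hz).resolve_left (Nat.cast_ne_zero.mpr m.succ_ne_zero)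
    rw [Finset.sum_insert ha, hza, map_zero, zero_add] at hy
    intro b hb
    rcases Finset.mem_insert.mp hb with rfl | hb
    · exact hza
    · exact ih m y hy b hb

theorem quantize_one_annihilate (x : V) (b : ι) :
    quantize χ χ' 1 (χ' b x) = χ' b (quantize χ χ' 1 x) - χ' b x := by
  have : ∀ a, χ a (χ' a (χ' b x)) = χ' b (χ a (χ' a x)) - if b = a then χ' a x else 0 := fun a => by
    have h1 := LinearMap.congr_fun (H.mixed b a) (χ' a x)
    have h2 := LinearMap.congr_fun (H.annihilate a b) x
    simp only [LinearMap.add_apply, Module.End.mul_apply, LinearMap.zero_apply] at h1 h2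
    rw [eq_neg_of_add_eq_zero_left h2, eq_sub_of_add_eq h1, map_neg]
    split_ifs <;> simp
  simp [quantize_one, LinearMap.sum_apply, this]

include hΩ in
theorem quantize_one_eq_self_iff (hvac : ∀ y, (∀ a, χ' a y = 0) → ∃ c : ℂ, y = c • Ω) (x : V) :
    quantize χ χ' 1 x = x ↔ x ∈ Submodule.span ℂ (Set.range fun a => χ a Ω) := by
  constructor
  · intro hx
    have hb : ∀ b, ∃ c : ℂ, χ' b x = c • Ω := fun b => hvac _ fun a => by
      have := H.quantize_one_annihilate x b
      rw [hx, sub_self, quantize_one] at this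
      refine H.annihilate_eq_zero_of_sum Finset.univ 0 _ ?_ a (Finset.mem_univ a)
      simpa [LinearMap.sum_apply] using this
    rw [← hx, quantize_one, LinearMap.sum_apply]
    refine Submodule.sum_mem _ fun b _ => ?_
    obtain ⟨c, hc⟩ := hb b
    rw [Module.End.mul_apply, hc, map_smul]
    exact Submodule.smul_mem _ _ (Submodule.subset_span ⟨b, rfl⟩)
  · intro hx
    induction hx using Submodule.span_induction with
    | mem x hx =>
      obtain ⟨c, rfl⟩ := hx
      simp [H.quantize_create_vacuum hΩ, Matrix.one_apply]
    | zero => rw [map_zero]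
    | add x y _ _ hx hy => rw [map_add, hx, hy]
    | smul c x _ hx => rw [map_smul, hx]

end IsCAR

end Fock

section SplitUnitary

open Matrix

theorem trace_fromBlocks {n R : Type*} [Fintype n] [AddCommMonoid R] (A B C D : Matrix n n R) :
    (fromBlocks A B C D).trace = A.trace + D.trace := by
  simp [trace]

variable (n : Type*) [Fintype n] [DecidableEq n]

/-- The real Lie algebra of trace zero matrices which are anti-Hermitian for the Hermitian form
of signature `(n, n)` pairing the two blocks. -/
def splitSpecialUnitary : LieSubalgebra ℝ (Matrix (n ⊕ n) (n ⊕ n) ℂ) where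
  carrier := {M | Mᴴ * fromBlocks 0 1 1 0 + fromBlocks 0 1 1 0 * M = 0 ∧ M.trace = 0}
  add_mem' := by
    rintro M N ⟨hM, hM'⟩ ⟨hN, hN'⟩
    refine ⟨?_, by rw [trace_add, hM', hN', add_zero]⟩
    rw [conjTranspose_add, add_mul, mul_add, add_add_add_comm, hM, hN, add_zero]
  zero_mem' := by simp
  smul_mem' := by
    rintro c M ⟨hM, hM'⟩
    refine ⟨?_, by rw [trace_smul, hM', smul_zero]⟩
    rw [conjTranspose_smul, smul_mul_assoc, mul_smul_comm, star_trivial, ← smul_add, hM, smul_zero]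
  lie_mem' := by
    rintro M N ⟨hM, _⟩ ⟨hN, _⟩
    refine ⟨?_, by rw [Ring.lie_def, trace_sub, trace_mul_comm, sub_self]⟩
    rw [Ring.lie_def, conjTranspose_sub, conjTranspose_mul, conjTranspose_mul]
    have hM := eq_neg_of_add_eq_zero_left hM
    have hN := eq_neg_of_add_eq_zero_left hN
    rw [sub_mul, mul_assoc, mul_assoc, hM, hN, mul_neg, mul_neg, ← mul_assoc, ← mul_assoc, hM, hN]
    noncomm_ring

variable {n}

theorem mem_splitSpecialUnitary_iff {M : Matrix (n ⊕ n) (n ⊕ n) ℂ} :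
    M ∈ splitSpecialUnitary n ↔ ∃ D H₁ H₂ : Matrix n n ℂ,
      D.trace.im = 0 ∧ H₁ᴴ = -H₁ ∧ H₂ᴴ = -H₂ ∧ M = fromBlocks D H₂ H₁ (-Dᴴ) := by
  constructor
  · rintro ⟨hM, hM'⟩
    rw [← fromBlocks_toBlocks M] at hM hM' ⊢
    generalize M.toBlocks₁₁ = A at *
    generalize M.toBlocks₁₂ = B at *
    generalize M.toBlocks₂₁ = C at *
    generalize M.toBlocks₂₂ = D at *
    rw [fromBlocks_conjTranspose, fromBlocks_multiply, fromBlocks_multiply, fromBlocks_add,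
      ← fromBlocks_zero, fromBlocks_inj] at hM
    simp only [mul_zero, mul_one, zero_add, add_zero, zero_mul, one_mul] at hM
    obtain ⟨h11, h12, h21, h22⟩ := hM
    have hD : D = -Aᴴ := (neg_eq_of_add_eq_zero_right h12).symm
    subst hD
    refine ⟨A, C, B, ?_, eq_neg_of_add_eq_zero_left h11, eq_neg_of_add_eq_zero_left h22, rfl⟩
    rw [trace_fromBlocks, trace_neg, trace_conjTranspose] at hM'
    have := congrArg Complex.im hM'
    simp at this
    linarith
  · rintro ⟨D, H₁, H₂, hD, h1, h2, rfl⟩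
    refine ⟨?_, ?_⟩
    · rw [fromBlocks_conjTranspose, fromBlocks_multiply, fromBlocks_multiply, fromBlocks_add,
        ← fromBlocks_zero, fromBlocks_inj]
      simp [h1, h2]
    · rw [trace_fromBlocks, trace_neg, trace_conjTranspose]
      apply Complex.ext
      · simp
      · simp [hD]

/-- The block diagonal matrix with blocks `D`, `-Dᴴ`. -/
def diagonalBlock : Matrix n n ℂ →ₗ[ℝ] Matrix (n ⊕ n) (n ⊕ n) ℂ where
  toFun D := fromBlocks D 0 0 (-Dᴴ)
  map_add' D E := by simp [fromBlocks_add, add_comm]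
  map_smul' c D := by simp [fromBlocks_smul]

/-- The matrix with lower left block `H`. -/
def lowerBlock : Matrix n n ℂ →ₗ[ℝ] Matrix (n ⊕ n) (n ⊕ n) ℂ where
  toFun H := fromBlocks 0 0 H 0
  map_add' D E := by simp [fromBlocks_add]
  map_smul' c D := by simp [fromBlocks_smul]

/-- The matrix with upper right block `H`. -/
def upperBlock : Matrix n n ℂ →ₗ[ℝ] Matrix (n ⊕ n) (n ⊕ n) ℂ where
  toFun H := fromBlocks 0 H 0 0
  map_add' D E := by simp [fromBlocks_add]
  map_smul' c D := by simp [fromBlocks_smul]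

omit [Fintype n] in
theorem single_eq_re_add_im (j k : n) (z : ℂ) :
    single j k z = z.re • single j k (1 : ℂ) + z.im • single j k Complex.I := by
  rw [smul_single, smul_single, ← single_add]
  congr 1
  apply Complex.ext <;> simp

theorem mem_of_conjTranspose_eq_neg {S : Submodule ℝ (Matrix n n ℂ)}
    (hdiag : ∀ j, single j j Complex.I ∈ S)
    (hre : ∀ j k, j ≠ k → single j k (1 : ℂ) - single k j 1 ∈ S)
    (him : ∀ j k, j ≠ k → single j k Complex.I + single k j Complex.I ∈ S)
    {H : Matrix n n ℂ} (hH : Hᴴ = -H) : H ∈ S := by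
  have key : ∀ j k (z : ℂ), single j k z - single k j (star z) ∈ S := fun j k z => by
    have : single j k z - single k j (star z) =
        z.re • (single j k (1 : ℂ) - single k j 1) +
          z.im • (single j k Complex.I + single k j Complex.I) := by
      rw [single_eq_re_add_im j k z, single_eq_re_add_im k j (star z)]
      simp only [Complex.star_def, Complex.conj_re, Complex.conj_im]
      module
    rw [this]
    by_cases hjk : j = k
    · subst hjk
      rw [sub_self, smul_zero, zero_add]
      exact S.smul_mem _ (S.add_mem (hdiag j) (hdiag j))
    · exact S.add_mem (S.smul_mem _ (hre j k hjk)) (S.smul_mem _ (him j k hjk))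
  have hH' : ∀ j k, star (H j k) = -H k j := fun j k => congrFun (congrFun hH k) j
  have h2 : H = (1 / 2 : ℝ) • ∑ j, ∑ k, (single j k (H j k) - single k j (star (H j k))) := by
    have hsum := matrix_eq_sum_single H
    have : ∑ j, ∑ k, (single j k (H j k) - single k j (star (H j k))) = H + H := by
      have hterm : ∀ j k, single j k (H j k) - single k j (star (H j k)) =
          single j k (H j k) + single k j (H k j) := fun j k => by
        rw [hH', ← single_neg, sub_neg_eq_add]
      simp only [hterm, Finset.sum_add_distrib]
      rw [Finset.sum_comm (f := fun j k => single k j (H k j)), ← hsum]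
    rw [this]
    module
  rw [h2]
  exact S.smul_mem _ (S.sum_mem fun j _ => S.sum_mem fun k _ => key j k _)

theorem mem_of_trace_im_eq_zero {S : Submodule ℝ (Matrix n n ℂ)} (o : n)
    (hre : ∀ j k, single j k (1 : ℂ) ∈ S) (him : ∀ j k, j ≠ k → single j k Complex.I ∈ S)
    (hdiag : ∀ j k, j ≠ k → single j j Complex.I - single k k Complex.I ∈ S)
    {D : Matrix n n ℂ} (hD : D.trace.im = 0) : D ∈ S := by
  have key : D = ∑ j, ∑ k, (single j k (D j k) -
      if j = k then (D j j).im • single o o Complex.I else 0) := by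
    have hsum := matrix_eq_sum_single D
    have h0 : ∑ j, (D j j).im • single o o Complex.I = 0 := by
      have : ∑ j, (D j j).im = 0 := by
        rw [← hD, trace, Complex.im_sum]; rfl
      rw [← Finset.sum_smul, this, zero_smul]
    simp only [Finset.sum_sub_distrib, Finset.sum_ite_eq, Finset.mem_univ, if_true, h0, sub_zero]
    exact hsum
  rw [key]
  refine S.sum_mem fun j _ => S.sum_mem fun k _ => ?_
  rw [single_eq_re_add_im]
  by_cases hjk : j = k
  · subst hjk
    rw [if_pos rfl, add_sub_assoc, ← smul_sub]
    refine S.add_mem (S.smul_mem _ (hre j j)) (S.smul_mem _ ?_)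
    by_cases hjo : j = o
    · rw [hjo, sub_self]; exact S.zero_mem
    · exact hdiag j o hjo
  · rw [if_neg hjk, sub_zero]
    exact S.add_mem (S.smul_mem _ (hre j k)) (S.smul_mem _ (him j k hjk))

theorem splitSpecialUnitary_le (hcard : ∀ j l : n, ∃ k, k ≠ j ∧ k ≠ l) (o : n)
    {𝔪 : LieSubalgebra ℝ (Matrix (n ⊕ n) (n ⊕ n) ℂ)}
    (hV : ∀ j, lowerBlock (single j j Complex.I) ∈ 𝔪)
    (hA : ∀ j, upperBlock (single j j Complex.I) ∈ 𝔪)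
    (hL : ∀ j k, j ≠ k → lowerBlock (single j k (1 : ℂ) - single k j 1) ∈ 𝔪)
    (hΛ : ∀ j k, j ≠ k → upperBlock (single j k (1 : ℂ) - single k j 1) ∈ 𝔪) :
    splitSpecialUnitary n ≤ 𝔪 := by
  have hlie : ∀ {M N}, M ∈ 𝔪 → N ∈ 𝔪 → M * N - N * M ∈ 𝔪 := fun hM hN => 𝔪.lie_mem hM hN
  have hd : ∀ {H₁ H₂ : Matrix n n ℂ}, H₁ᴴ = -H₁ → H₂ᴴ = -H₂ → lowerBlock H₁ ∈ 𝔪 →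
      upperBlock H₂ ∈ 𝔪 → diagonalBlock (H₂ * H₁) ∈ 𝔪 := fun {H₁ H₂} h1 h2 hH₁ hH₂ => by
    convert hlie hH₂ hH₁ using 1
    simp [diagonalBlock, lowerBlock, upperBlock, fromBlocks_multiply, sub_eq_add_neg,
      fromBlocks_neg, fromBlocks_add, h1, h2]
  have hlo : ∀ {D H : Matrix n n ℂ}, diagonalBlock D ∈ 𝔪 → lowerBlock H ∈ 𝔪 →
      lowerBlock (Dᴴ * H + H * D) ∈ 𝔪 := fun {D H} hD hH => by
    convert hlie hH hD using 1
    simp [diagonalBlock, lowerBlock, fromBlocks_multiply, sub_eq_add_neg,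
      fromBlocks_neg, fromBlocks_add, add_comm]
  have hup : ∀ {D H : Matrix n n ℂ}, diagonalBlock D ∈ 𝔪 → upperBlock H ∈ 𝔪 →
      upperBlock (D * H + H * Dᴴ) ∈ 𝔪 := fun {D H} hD hH => by
    convert hlie hD hH using 1
    simp [diagonalBlock, upperBlock, fromBlocks_multiply, sub_eq_add_neg,
      fromBlocks_neg, fromBlocks_add]
  have hdd : ∀ {D D' : Matrix n n ℂ}, diagonalBlock D ∈ 𝔪 → diagonalBlock D' ∈ 𝔪 →
      diagonalBlock (D * D' - D' * D) ∈ 𝔪 := fun {D D'} hD hD' => by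
    convert hlie hD hD' using 1
    simp [diagonalBlock, fromBlocks_multiply, sub_eq_add_neg, fromBlocks_neg, fromBlocks_add,
      add_comm]
  have aI : ∀ j : n, (single j j Complex.I)ᴴ = -single j j Complex.I := fun j => by
    rw [conjTranspose_single, single_neg]; simp
  have aR : ∀ j k : n, (single j k (1 : ℂ) - single k j 1)ᴴ = -(single j k (1 : ℂ) - single k j 1) :=
    fun j k => by
      rw [conjTranspose_sub, conjTranspose_single, conjTranspose_single]; simp
  have hre : ∀ j k, j ≠ k → diagonalBlock (single j k (1 : ℂ)) ∈ 𝔪 := fun j k hjk => by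
    obtain ⟨l, hlj, hlk⟩ := hcard j k
    have := hd (aR k l) (aR l j) (hL k l hlk.symm) (hΛ l j hlj)
    simp only [mul_sub, sub_mul, single_mul_single_same, mul_one,
      single_mul_single_of_ne _ _ _ _ hjk, single_mul_single_of_ne _ _ _ _ hlj.symm,
      single_mul_single_of_ne _ _ _ _ hlk, sub_zero, zero_sub, sub_neg_eq_add, zero_add] at this
    exact this
  have him : ∀ j k, j ≠ k → diagonalBlock (single j k Complex.I) ∈ 𝔪 := fun j k hjk => by
    have := hd (aR j k) (aI j) (hL j k hjk) (hA j)
    simp only [mul_sub, single_mul_single_same, mul_one,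
      single_mul_single_of_ne _ _ _ _ hjk, sub_zero] at this
    exact this
  have hreD : ∀ j, diagonalBlock (single j j (1 : ℂ)) ∈ 𝔪 := fun j => by
    have := hd (aI j) (aI j) (hV j) (hA j)
    rw [single_mul_single_same, Complex.I_mul_I, ← single_neg, map_neg] at this
    exact neg_mem_iff.mp this
  have hdiag : ∀ j k, j ≠ k →
      diagonalBlock (single j j Complex.I - single k k Complex.I) ∈ 𝔪 := fun j k hjk => by
    have := hdd (hre j k hjk) (him k j hjk.symm)
    simpa only [single_mul_single_same, one_mul, mul_one] using this
  have hloI : ∀ j k, j ≠ k → lowerBlock (single j k Complex.I + single k j Complex.I) ∈ 𝔪 :=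
    fun j k hjk => by
      have := hlo (hre j k hjk) (hV j)
      rw [conjTranspose_single, single_mul_single_same, single_mul_single_same, add_comm] at this
      simpa using this
  have hupI : ∀ j k, j ≠ k → upperBlock (single j k Complex.I + single k j Complex.I) ∈ 𝔪 :=
    fun j k hjk => by
      have := hup (hre j k hjk) (hA k)
      rw [conjTranspose_single, single_mul_single_same, single_mul_single_same] at this
      simpa using this
  intro M hM
  obtain ⟨D, H₁, H₂, hD, h1, h2, rfl⟩ := mem_splitSpecialUnitary_iff.mp hM
  have hsum : fromBlocks D H₂ H₁ (-Dᴴ) = diagonalBlock D + lowerBlock H₁ + upperBlock H₂ := by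
    simp [diagonalBlock, lowerBlock, upperBlock, fromBlocks_add]
  rw [hsum]
  refine 𝔪.add_mem (𝔪.add_mem ?_ ?_) ?_
  · refine mem_of_trace_im_eq_zero (S := 𝔪.toSubmodule.comap diagonalBlock) o (fun j k => ?_)
      him hdiag hD
    by_cases hjk : j = k
    · subst hjk; exact hreD j
    · exact hre j k hjk
  · exact mem_of_conjTranspose_eq_neg (S := 𝔪.toSubmodule.comap lowerBlock) hV hL hloI h1
  · exact mem_of_conjTranspose_eq_neg (S := 𝔪.toSubmodule.comap upperBlock) hA hΛ hupI h2

end SplitUnitary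

namespace AdaptedCoframe

variable {W : Type*} [AddCommGroup W] [Module ℝ W] {s : ℕ} {h : LinearMap.BilinForm ℝ W}
  {η : Fin (s + 1) → Fin (s + 1) → ⋀[ℝ]^2 W} (v : AdaptedCoframe s h η)

theorem eq_zero_of_eq_neg_self {V : Type*} [AddCommGroup V] [Module ℂ V] {x : V} (hx : x = -x) :
    x = 0 := by
  have : (2 : ℂ) • x = 0 := by
    rw [two_smul]
    exact add_eq_zero_iff_eq_neg.mpr hx
  exact (smul_eq_zero.mp this).resolve_left two_ne_zero

/-- The form `w 0 ∧ ⋯ ∧ w s`. -/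
def vacuum : ℂ ⊗[ℝ] ExteriorAlgebra ℝ W := (List.ofFn v.w).prod

theorem annihilate_w_mul_of_ne (ε : ℂ) {j k : Fin (s + 1)} (hjk : j ≠ k)
    (z : ℂ ⊗[ℝ] ExteriorAlgebra ℝ W) :
    v.annihilate ε j (v.w k * z) = -(v.w k * v.annihilate ε j z) := by
  rw [w_mul, w_mul, eq_neg_iff_add_eq_zero]
  have := LinearMap.congr_fun (v.annihilate_create ε 1 j k) z
  rwa [if_neg hjk, smul_zero] at this

theorem annihilate_one_w_mul (j : Fin (s + 1)) (z : ℂ ⊗[ℝ] ExteriorAlgebra ℝ W) :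
    v.annihilate 1 j (v.w j * z) = z - v.w j * v.annihilate 1 j z := by
  rw [w_mul, w_mul, eq_sub_iff_add_eq]
  have := LinearMap.congr_fun (v.annihilate_create 1 1 j j) z
  rw [if_pos rfl] at this
  norm_num at this
  exact this

theorem annihilate_neg_one_w_mul (j k : Fin (s + 1)) (z : ℂ ⊗[ℝ] ExteriorAlgebra ℝ W) :
    v.annihilate (-1) j (v.w k * z) = -(v.w k * v.annihilate (-1) j z) := by
  rw [w_mul, w_mul, eq_neg_iff_add_eq_zero]
  have := LinearMap.congr_fun (v.annihilate_create (-1) 1 j k) z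
  norm_num at this
  exact this

theorem create_mul_swap (ε ε' : ℂ) (j k : Fin (s + 1)) (z : ℂ ⊗[ℝ] ExteriorAlgebra ℝ W) :
    v.create ε j (v.create ε' k z) = -v.create ε' k (v.create ε j z) :=
  eq_neg_of_add_eq_zero_left (LinearMap.congr_fun (v.create_anticomm ε ε' j k) z)

theorem w_mul_w (j k : Fin (s + 1)) : v.w j * v.w k = -(v.w k * v.w j) := by
  have := v.create_mul_swap 1 1 j k 1
  simpa only [← w_mul, mul_one] using this

theorem wBar_mul_w (j k : Fin (s + 1)) : v.wBar j * v.w k = -(v.w k * v.wBar j) := by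
  have := v.create_mul_swap (-1) 1 j k 1
  simpa only [← w_mul, ← wBar_mul, mul_one] using this

theorem w_mul_self (j : Fin (s + 1)) : v.w j * v.w j = 0 :=
  eq_zero_of_eq_neg_self (v.w_mul_w j j)

theorem w_mul_vacuum (j : Fin (s + 1)) : v.w j * v.vacuum = 0 := by
  rw [vacuum, mul_prod_ofFn (v.w j) 0 (s + 1) v.w v.w j (fun _ _ => rfl) (fun k _ => v.w_mul_w j k)
    (by rw [w_mul_self, zero_smul]), mul_zero, zero_smul]

theorem fill_vacuum (a : Fin (s + 1) ⊕ Fin (s + 1)) : v.fill a v.vacuum = 0 := by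
  rcases a with j | j
  · rw [fill, LinearMap.smul_apply, ← w_mul, w_mul_vacuum, smul_zero]
  · rw [fill, LinearMap.smul_apply, vacuum, map_prod_ofFn_eq_zero _ (v.annihilate_one _ _) _ _
      fun k z => v.annihilate_neg_one_w_mul j k z, smul_zero]

theorem hole_vacuum (a : Fin (s + 1) ⊕ Fin (s + 1)) : v.hole a v.vacuum = v.c a := by
  have hsq : ∀ j : Fin (s + 1), ((-1) ^ (j : ℕ) * (-1) ^ (j : ℕ) : ℂ) = 1 := fun j => by
    rw [← mul_pow]; simp
  rcases a with r | r
  · rw [hole, LinearMap.smul_apply, vacuum, map_prod_ofFn _ (v.annihilate_one _ _) _ _ r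
      (fun j hj z => v.annihilate_w_mul_of_ne 1 hj.symm z) (v.annihilate_one_w_mul r), smul_smul,
      hsq, one_smul, c]
  · rw [hole, LinearMap.smul_apply, ← wBar_mul, vacuum, mul_prod_ofFn (v.wBar r) (-1) (s + 1) v.w
      (fun j => if j = r then v.w j * v.wBar j else v.w j) r (fun j hj => if_neg hj)
      (fun k _ => v.wBar_mul_w r k) (by rw [if_pos rfl, wBar_mul_w, neg_one_smul]), smul_smul,
      mul_neg_one, neg_mul_neg, hsq, one_smul, c]

instance : Nontrivial (ℂ ⊗[ℝ] ExteriorAlgebra ℝ W) := by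
  refine ⟨1, 0, fun h01 => ?_⟩
  have := congrArg rePart h01
  rw [Algebra.TensorProduct.one_def, rePart_tmul, map_zero, Complex.one_re, one_smul] at this
  exact one_ne_zero this

theorem vacuum_ne_zero : v.vacuum ≠ 0 :=
  prod_ofFn_ne_zero (s + 1) v.w (fun j => v.annihilate 1 j) (fun j => v.annihilate_one 1 j)
    (fun _ _ hjk z => v.annihilate_w_mul_of_ne 1 hjk z) v.annihilate_one_w_mul

theorem eq_zero_of_sign_smul {V : Type*} [AddCommGroup V] [Module ℂ V] {m : ℕ} {x : V}
    (hx : ((-1) ^ m : ℂ) • x = 0) : x = 0 :=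
  (smul_eq_zero.mp hx).resolve_left (pow_ne_zero _ (neg_ne_zero.mpr one_ne_zero))

theorem contractC_eq_zero {z : ℂ ⊗[ℝ] ExteriorAlgebra ℝ W} (h1 : ∀ j, v.annihilate 1 j z = 0)
    (h2 : ∀ j, v.annihilate (-1) j z = 0) (a : Fin 2 × Fin (s + 1)) : v.contractC a z = 0 := by
  obtain ⟨i, j⟩ := a
  have hr : ((1 / √2 : ℝ) : ℂ) ≠ 0 := fun h0 => by
    have := one_div_sqrt_two_mul_self
    rw [h0] at this
    norm_num at this
  have e1 := (smul_eq_zero.mp (h1 j)).resolve_left hr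
  have e2 := (smul_eq_zero.mp (h2 j)).resolve_left hr
  simp only [LinearMap.sub_apply, LinearMap.smul_apply] at e1 e2
  fin_cases i
  · change v.contractC (0, j) z = 0
    linear_combination (norm := module) (1 / 2 : ℂ) • e1 + (1 / 2 : ℂ) • e2
  · change v.contractC (1, j) z = 0
    have : Complex.I • v.contractC (1, j) z = 0 := by
      linear_combination (norm := module) (-1 / 2 : ℂ) • e1 + (1 / 2 : ℂ) • e2
    exact (smul_eq_zero.mp this).resolve_left Complex.I_ne_zero

theorem eq_smul_vacuum {y : ℂ ⊗[ℝ] ExteriorAlgebra ℝ W} (hy : ∀ a, v.fill a y = 0) :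
    ∃ c : ℂ, y = c • v.vacuum := by
  have hw : ∀ j, v.w j * y = 0 := fun j => by
    have := hy (Sum.inl j)
    rw [fill, LinearMap.smul_apply, ← w_mul] at this
    exact eq_zero_of_sign_smul this
  have ha : ∀ j, v.annihilate (-1) j y = 0 := fun j => by
    have := hy (Sum.inr j)
    rw [fill, LinearMap.smul_apply, neg_smul, neg_eq_zero] at this
    exact eq_zero_of_sign_smul this
  have hswap : ∀ (ε ε' : ℂ) j k z,
      v.annihilate ε j (v.annihilate ε' k z) = -v.annihilate ε' k (v.annihilate ε j z) :=
    fun ε ε' j k z =>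
      eq_neg_of_add_eq_zero_left (LinearMap.congr_fun (v.annihilate_anticomm ε ε' j k) z)
  obtain ⟨z, hz, h1, hG⟩ := exists_eq_prod_ofFn_mul (s + 1) v.w (fun j => v.annihilate 1 j)
    (fun _ _ hjk z => v.annihilate_w_mul_of_ne 1 hjk z) v.annihilate_one_w_mul
    (fun j k z => hswap 1 1 j k z) (fun j z => eq_zero_of_eq_neg_self (hswap 1 1 j j z)) y hw
  obtain ⟨c, rfl⟩ := v.eq_smul_one_of_contractC
    (v.contractC_eq_zero h1 fun j => hG _ (ha j) fun k z => hswap (-1) 1 j k z)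
  exact ⟨c, by rw [hz, mul_smul_comm, mul_one]; rfl⟩

theorem h_basis (a : Fin 2 × Fin (s + 1)) : h (v.basis a) = v.basis.coord a :=
  v.basis.ext fun b => by simp [v.orthonormal, Finsupp.single_apply, eq_comm]

theorem baseChange_J : v.J.baseChange ℂ = ∑ j, (v.wedgeC (1, j) * v.contractC (0, j) -
    v.wedgeC (0, j) * v.contractC (1, j)) := by
  have hJ : v.J = ∑ j, (wedge (ExteriorAlgebra.ι ℝ (v.basis (1, j))) * contract (h (v.basis (0, j)))
      - wedge (ExteriorAlgebra.ι ℝ (v.basis (0, j))) * contract (h (v.basis (1, j)))) := by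
    refine LinearMap.ext fun x => ?_
    rw [J, derivationExt_eq_sum v.basis, Fintype.sum_prod_type, Fin.sum_univ_two,
      ← Finset.sum_add_distrib, LinearMap.sum_apply]
    refine Finset.sum_congr rfl fun j _ => ?_
    simp only [complexStructure, Module.Basis.constr_basis]
    simp [wedge, h_basis, sub_eq_add_neg]
  rw [hJ]
  change Module.End.baseChangeHom ℝ ℂ _ _ = _
  rw [map_sum]
  refine Finset.sum_congr rfl fun j _ => ?_
  rw [map_sub, map_mul, map_mul]
  rfl

theorem baseChange_J_eq_quantize :
    v.J.baseChange ℂ = Complex.I • (quantize v.hole v.fill 1 - ((s : ℂ) + 1) • 1) := by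
  have hsq : ∀ j : Fin (s + 1), ((-1) ^ (j : ℕ) * (-1) ^ (j : ℕ) : ℂ) = 1 := fun j => by
    rw [← mul_pow]; simp
  have hcard : ((s : ℂ) + 1) • (1 : Module.End ℂ (ℂ ⊗[ℝ] ExteriorAlgebra ℝ W)) =
      ∑ _j : Fin (s + 1), 1 := by
    rw [Finset.sum_const, Finset.card_univ, Fintype.card_fin, ← Nat.cast_smul_eq_nsmul ℂ]
    push_cast
    rfl
  rw [baseChange_J, quantize_one, Fintype.sum_sum_type, ← Finset.sum_add_distrib, hcard,
    ← Finset.sum_sub_distrib, Finset.smul_sum]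
  refine Finset.sum_congr rfl fun j _ => ?_
  have H := v.annihilate_create 1 1 j j
  rw [if_pos rfl, create_mul_annihilate] at H
  simp only [hole, fill, smul_mul_smul_comm, neg_mul_neg, hsq, create_mul_annihilate]
  rw [eq_sub_of_add_eq H]
  simp only [smul_add, smul_sub, smul_smul]
  ring_nf
  simp only [Complex.I_sq]
  module

theorem mem_weightSpace_iff (x : ℂ ⊗[ℝ] ExteriorAlgebra ℝ W) :
    x ∈ v.weightSpace (-s) ↔ x ∈ Submodule.span ℂ (Set.range v.c) := by
  have hc : v.c = fun a => v.hole a v.vacuum := funext fun a => (v.hole_vacuum a).symm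
  rw [hc, ← v.isCAR_hole.quantize_one_eq_self_iff v.fill_vacuum fun y => v.eq_smul_vacuum,
    weightSpace, Module.End.mem_eigenspace_iff, baseChange_J_eq_quantize, LinearMap.smul_apply,
    mul_smul, smul_right_inj Complex.I_ne_zero, LinearMap.sub_apply, LinearMap.smul_apply,
    Module.End.one_apply, sub_eq_iff_eq_add, ← add_smul]
  push_cast
  rw [neg_add_cancel_left, one_smul]

theorem linearIndependent_c : LinearIndependent ℂ v.c := by
  have hc : v.c = fun a => v.hole a v.vacuum := funext fun a => (v.hole_vacuum a).symm
  rw [hc]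
  exact v.isCAR_hole.linearIndependent_create_vacuum v.fill_vacuum v.vacuum_ne_zero

/-- The basis `c` of the space of forms of weight `-s`. -/
def weightBasis :
    Module.Basis (Fin (s + 1) ⊕ Fin (s + 1)) ℂ (v.weightSpace (-s)) :=
  (Module.Basis.span v.linearIndependent_c).map
    (LinearEquiv.ofEq _ _ (SetLike.ext v.mem_weightSpace_iff).symm)

theorem weightBasis_apply (a : Fin (s + 1) ⊕ Fin (s + 1)) :
    (v.weightBasis a : ℂ ⊗[ℝ] ExteriorAlgebra ℝ W) = v.c a := by
  simp [weightBasis, Module.Basis.span_apply]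

end AdaptedCoframe

theorem lowerBlock_single {n : Type*} [Fintype n] [DecidableEq n] (j k : n) (z : ℂ) :
    lowerBlock (Matrix.single j k z) = Matrix.single (Sum.inr j) (Sum.inl k) z := by
  ext (a | a) (b | b) <;> simp [lowerBlock, Matrix.single_apply]

theorem upperBlock_single {n : Type*} [Fintype n] [DecidableEq n] (j k : n) (z : ℂ) :
    upperBlock (Matrix.single j k z) = Matrix.single (Sum.inl j) (Sum.inr k) z := by
  ext (a | a) (b | b) <;> simp [upperBlock, Matrix.single_apply]

theorem lowerBlock_mem_splitSpecialUnitary {n : Type*} [Fintype n] [DecidableEq n]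
    {H : Matrix n n ℂ} (hH : Hᴴ = -H) : lowerBlock H ∈ splitSpecialUnitary n :=
  mem_splitSpecialUnitary_iff.mpr ⟨0, H, 0, by simp, hH, by simp, by simp [lowerBlock]⟩

theorem upperBlock_mem_splitSpecialUnitary {n : Type*} [Fintype n] [DecidableEq n]
    {H : Matrix n n ℂ} (hH : Hᴴ = -H) : upperBlock H ∈ splitSpecialUnitary n :=
  mem_splitSpecialUnitary_iff.mpr ⟨0, 0, H, by simp, by simp, hH, by simp [upperBlock]⟩

theorem conjTranspose_single_I {n : Type*} [DecidableEq n] (j : n) :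
    (Matrix.single j j Complex.I)ᴴ = -Matrix.single j j Complex.I := by
  rw [Matrix.conjTranspose_single, Matrix.single_neg]; simp

theorem conjTranspose_single_sub_single {n : Type*} [DecidableEq n] (j k : n) :
    (Matrix.single j k (1 : ℂ) - Matrix.single k j 1)ᴴ =
      -(Matrix.single j k (1 : ℂ) - Matrix.single k j 1) := by
  rw [Matrix.conjTranspose_sub, Matrix.conjTranspose_single, Matrix.conjTranspose_single]; simp

namespace AdaptedCoframe

variable {W : Type*} [AddCommGroup W] [Module ℝ W] {s : ℕ} {h : LinearMap.BilinForm ℝ W}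
  {η : Fin (s + 1) → Fin (s + 1) → ⋀[ℝ]^2 W} (v : AdaptedCoframe s h η)

/-- The extension of real operators to complex forms. -/
def complexify : Module.End ℝ (ExteriorAlgebra ℝ W) →ₗ⁅ℝ⁆
    Module.End ℂ (ℂ ⊗[ℝ] ExteriorAlgebra ℝ W) :=
  (Module.End.baseChangeHom ℝ ℂ (ExteriorAlgebra ℝ W)).toLieHom

theorem complexify_apply (T : Module.End ℝ (ExteriorAlgebra ℝ W)) :
    complexify T = T.baseChange ℂ := rfl

/-- The action of matrices on complex forms by operators quadratic in `hole` and `fill`. -/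
def action : Matrix (Fin (s + 1) ⊕ Fin (s + 1)) (Fin (s + 1) ⊕ Fin (s + 1)) ℂ →ₗ⁅ℝ⁆
    Module.End ℂ (ℂ ⊗[ℝ] ExteriorAlgebra ℝ W) where
  toFun := quantize v.hole v.fill
  map_add' := map_add _
  map_smul' c M := ((quantize v.hole v.fill).restrictScalars ℝ).map_smul c M
  map_lie' {M N} := by
    rw [Ring.lie_def, Ring.lie_def]
    exact v.isCAR_hole.quantize_lie M N

theorem action_apply (M : Matrix (Fin (s + 1) ⊕ Fin (s + 1)) (Fin (s + 1) ⊕ Fin (s + 1)) ℂ) :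
    v.action M = quantize v.hole v.fill M := rfl

theorem action_c (M : Matrix (Fin (s + 1) ⊕ Fin (s + 1)) (Fin (s + 1) ⊕ Fin (s + 1)) ℂ)
    (b : Fin (s + 1) ⊕ Fin (s + 1)) : v.action M (v.c b) = ∑ a, M a b • v.c a := by
  simp only [← hole_vacuum, action_apply, v.isCAR_hole.quantize_create_vacuum v.fill_vacuum]

theorem sign_mul_self (j : Fin (s + 1)) : ((-1) ^ (j : ℕ) * (-1) ^ (j : ℕ) : ℂ) = 1 := by
  rw [← mul_pow]; simp

theorem complexify_V (j : Fin (s + 1)) :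
    complexify (v.V j) = v.action (lowerBlock (Matrix.single j j Complex.I)) := by
  have hV : complexify (v.V j) = v.wedgeC (0, j) * v.wedgeC (1, j) := by
    rw [wedgeC, wedgeC, ← LinearMap.baseChange_mul, complexify_apply, V, wedge,
      LinearMap.mulLeft_mul]
    rfl
  have H := v.isCAR_wedgeC.create
  rw [hV, lowerBlock_single, action_apply, quantize_single, hole, fill, smul_mul_smul_comm,
    neg_mul, sign_mul_self, create_mul_create, eq_zero_of_eq_neg_self
      (eq_neg_of_add_eq_zero_left (H (0, j) (0, j))), eq_zero_of_eq_neg_self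
      (eq_neg_of_add_eq_zero_left (H (1, j) (1, j))),
    eq_neg_of_add_eq_zero_left (H (1, j) (0, j))]
  simp only [smul_add, smul_sub, smul_neg, smul_smul, smul_zero]
  ring_nf
  simp only [Complex.I_sq]
  module

theorem contractC_mul_eq_action (j : Fin (s + 1)) :
    v.contractC (1, j) * v.contractC (0, j) =
      v.action (-upperBlock (Matrix.single j j Complex.I)) := by
  have H := v.isCAR_wedgeC.annihilate
  rw [map_neg, upperBlock_single, action_apply, quantize_single, hole, fill, smul_mul_smul_comm,
    mul_neg, sign_mul_self, annihilate_mul_annihilate, eq_zero_of_eq_neg_self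
      (eq_neg_of_add_eq_zero_left (H (0, j) (0, j))), eq_zero_of_eq_neg_self
      (eq_neg_of_add_eq_zero_left (H (1, j) (1, j))),
    eq_neg_of_add_eq_zero_left (H (1, j) (0, j))]
  simp only [smul_add, smul_sub, smul_neg, smul_smul, smul_zero]
  ring_nf
  simp only [Complex.I_sq]
  module

theorem complexify_L (j k : Fin (s + 1)) :
    complexify (v.L j k) = v.wedgeC (0, j) * v.wedgeC (0, k) + v.wedgeC (1, j) * v.wedgeC (1, k) := by
  rw [wedgeC, wedgeC, wedgeC, wedgeC, ← LinearMap.baseChange_mul, ← LinearMap.baseChange_mul,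
    ← LinearMap.baseChange_add, complexify_apply, L, v.form_eq, Fin.sum_univ_two]
  congr 1
  refine LinearMap.ext fun x => ?_
  simp [wedge, add_mul, mul_assoc]

/-- The sign relating the operators `L j k` to matrices. -/
def pairSign (j k : Fin (s + 1)) : ℝ := (-1) ^ (j : ℕ) * (-1) ^ (k : ℕ)

theorem pairSign_mul_self (j k : Fin (s + 1)) : pairSign j k * pairSign j k = 1 := by
  rw [pairSign, mul_mul_mul_comm, ← mul_pow, ← mul_pow]
  simp

theorem action_pairSign_smul (j k : Fin (s + 1))
    (M : Matrix (Fin (s + 1) ⊕ Fin (s + 1)) (Fin (s + 1) ⊕ Fin (s + 1)) ℂ) :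
    v.action (pairSign j k • M) = ((-1) ^ (j : ℕ) * (-1) ^ (k : ℕ) : ℂ) • v.action M := by
  have : pairSign j k • M = ((-1) ^ (j : ℕ) * (-1) ^ (k : ℕ) : ℂ) • M := by
    ext a b
    simp [pairSign, Complex.real_smul]
  rw [this, action_apply, map_smul, action_apply]

theorem smul_neg_smul_sub {V : Type*} [AddCommGroup V] [Module ℂ V] {e : ℂ} (he : e * e = 1)
    (x y : V) : e • (-e • x - -e • y) = y - x := by
  linear_combination (norm := module) he • (y - x)

theorem complexify_L_eq_action (j k : Fin (s + 1)) : complexify (v.L j k) =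
    v.action (pairSign j k • lowerBlock (Matrix.single k j (1 : ℂ) - Matrix.single j k 1)) := by
  have H := v.isCAR_wedgeC.create
  have hs : ((-1) ^ (j : ℕ) * (-1) ^ (k : ℕ) * ((-1) ^ (j : ℕ) * (-1) ^ (k : ℕ)) : ℂ) = 1 := by
    rw [mul_mul_mul_comm, sign_mul_self, sign_mul_self, one_mul]
  rw [complexify_L, action_pairSign_smul, map_sub, lowerBlock_single, lowerBlock_single,
    action_apply, map_sub, quantize_single, quantize_single, hole, hole, fill, fill,
    smul_mul_smul_comm, smul_mul_smul_comm, neg_mul, neg_mul,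
    mul_comm ((-1 : ℂ) ^ (k : ℕ)), one_smul, one_smul]
  refine Eq.trans ?_ (smul_neg_smul_sub hs _ _).symm
  rw [create_mul_create, create_mul_create, eq_neg_of_add_eq_zero_left (H (0, k) (0, j)),
    eq_neg_of_add_eq_zero_left (H (1, k) (1, j)), eq_neg_of_add_eq_zero_left (H (1, k) (0, j)),
    eq_neg_of_add_eq_zero_left (H (0, k) (1, j))]
  module

theorem contractC_add_eq_action (j k : Fin (s + 1)) :
    v.contractC (0, k) * v.contractC (0, j) + v.contractC (1, k) * v.contractC (1, j) =
    v.action (pairSign j k • upperBlock (Matrix.single j k (1 : ℂ) - Matrix.single k j 1)) := by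
  have H := v.isCAR_wedgeC.annihilate
  have hs : ((-1) ^ (j : ℕ) * (-1) ^ (k : ℕ) * ((-1) ^ (j : ℕ) * (-1) ^ (k : ℕ)) : ℂ) = 1 := by
    rw [mul_mul_mul_comm, sign_mul_self, sign_mul_self, one_mul]
  rw [action_pairSign_smul, map_sub, upperBlock_single, upperBlock_single,
    action_apply, map_sub, quantize_single, quantize_single, hole, hole, fill, fill,
    smul_mul_smul_comm, smul_mul_smul_comm, mul_neg, mul_neg,
    mul_comm ((-1 : ℂ) ^ (k : ℕ)), one_smul, one_smul]
  refine Eq.trans ?_ (smul_neg_smul_sub hs _ _).symm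
  rw [annihilate_mul_annihilate, annihilate_mul_annihilate,
    eq_neg_of_add_eq_zero_left (H (0, k) (0, j)),
    eq_neg_of_add_eq_zero_left (H (1, k) (1, j)), eq_neg_of_add_eq_zero_left (H (1, k) (0, j)),
    eq_neg_of_add_eq_zero_left (H (0, k) (1, j))]
  module

theorem isAdjointPair_wedge (a b : Fin 2 × Fin (s + 1)) :
    LinearMap.IsAdjointPair (formMetric h) (formMetric h)
      (wedge (ExteriorAlgebra.ι ℝ (v.basis a) * ExteriorAlgebra.ι ℝ (v.basis b)))
      (contract (h (v.basis b)) * contract (h (v.basis a)) :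
        Module.End ℝ (ExteriorAlgebra ℝ W)) := fun x y => by
  rw [wedge, LinearMap.mulLeft_apply, mul_assoc, formMetric_ι_mul, formMetric_ι_mul]
  rfl

include v in
theorem isAdjointPair_unique {S T T' : Module.End ℝ (ExteriorAlgebra ℝ W)}
    (hT : LinearMap.IsAdjointPair (formMetric h) (formMetric h) S T)
    (hT' : LinearMap.IsAdjointPair (formMetric h) (formMetric h) S T') : T = T' :=
  LinearMap.ext fun y => sub_eq_zero.mp <|
    formMetric_separatingRight h v.basis v.orthonormal fun x => by
      rw [map_sub, ← hT x y, ← hT' x y, sub_self]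

/-- The adjoint of `V j`. -/
def adjointV (j : Fin (s + 1)) : Module.End ℝ (ExteriorAlgebra ℝ W) :=
  contract (h (v.basis (1, j))) * contract (h (v.basis (0, j)))

/-- The adjoint of `L j k`. -/
def adjointL (j k : Fin (s + 1)) : Module.End ℝ (ExteriorAlgebra ℝ W) :=
  contract (h (v.basis (0, k))) * contract (h (v.basis (0, j))) +
    contract (h (v.basis (1, k))) * contract (h (v.basis (1, j)))

theorem isAdjointPair_V (j : Fin (s + 1)) :
    LinearMap.IsAdjointPair (formMetric h) (formMetric h) (v.V j) (v.adjointV j) :=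
  v.isAdjointPair_wedge (0, j) (1, j)

theorem isAdjointPair_L (j k : Fin (s + 1)) :
    LinearMap.IsAdjointPair (formMetric h) (formMetric h) (v.L j k) (v.adjointL j k) := by
  have hL : v.L j k =
      wedge (ExteriorAlgebra.ι ℝ (v.basis (0, j)) * ExteriorAlgebra.ι ℝ (v.basis (0, k))) +
      wedge (ExteriorAlgebra.ι ℝ (v.basis (1, j)) * ExteriorAlgebra.ι ℝ (v.basis (1, k))) := by
    refine LinearMap.ext fun x => ?_
    simp [L, v.form_eq, wedge, Fin.sum_univ_two, add_mul, mul_assoc]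
  rw [hL, adjointL]
  intro x y
  rw [LinearMap.add_apply, LinearMap.add_apply, map_add, map_add, LinearMap.add_apply]
  exact congrArg₂ (· + ·) (v.isAdjointPair_wedge _ _ x y) (v.isAdjointPair_wedge _ _ x y)

theorem complexify_adjointV (j : Fin (s + 1)) : complexify (v.adjointV j) =
    v.action (-upperBlock (Matrix.single j j Complex.I)) := by
  rw [← contractC_mul_eq_action, contractC, contractC, ← LinearMap.baseChange_mul]
  rfl

theorem complexify_adjointL (j k : Fin (s + 1)) : complexify (v.adjointL j k) =
    v.action (pairSign j k • upperBlock (Matrix.single j k (1 : ℂ) - Matrix.single k j 1)) := by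
  rw [← contractC_add_eq_action, contractC, contractC, contractC, contractC,
    ← LinearMap.baseChange_mul, ← LinearMap.baseChange_mul, ← LinearMap.baseChange_add]
  rfl

theorem V_mem_fibreAlgebra (j : Fin (s + 1)) : v.V j ∈ v.fibreAlgebra :=
  LieSubalgebra.subset_lieSpan (Or.inl (Or.inr ⟨j, rfl⟩))

theorem L_mem_fibreAlgebra {j k : Fin (s + 1)} (hjk : j ≠ k) : v.L j k ∈ v.fibreAlgebra :=
  LieSubalgebra.subset_lieSpan (Or.inl (Or.inl ⟨j, k, hjk, rfl⟩))

theorem adjointV_mem_fibreAlgebra (j : Fin (s + 1)) : v.adjointV j ∈ v.fibreAlgebra :=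
  LieSubalgebra.subset_lieSpan (Or.inr ⟨v.V j, Or.inr ⟨j, rfl⟩, v.isAdjointPair_V j⟩)

theorem adjointL_mem_fibreAlgebra {j k : Fin (s + 1)} (hjk : j ≠ k) :
    v.adjointL j k ∈ v.fibreAlgebra :=
  LieSubalgebra.subset_lieSpan (Or.inr ⟨v.L j k, Or.inl ⟨j, k, hjk, rfl⟩, v.isAdjointPair_L j k⟩)

theorem exists_action_eq {T : Module.End ℝ (ExteriorAlgebra ℝ W)} (hT : T ∈ v.fibreAlgebra) :
    ∃ M ∈ splitSpecialUnitary (Fin (s + 1)), v.action M = complexify T := by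
  suffices v.fibreAlgebra ≤
      ((splitSpecialUnitary (Fin (s + 1))).map v.action).comap complexify from this hT
  refine LieSubalgebra.lieSpan_le.mpr ?_
  rintro T ((⟨j, k, _, rfl⟩ | ⟨j, rfl⟩) | ⟨S, ⟨j, k, _, rfl⟩ | ⟨j, rfl⟩, hST⟩)
  · exact ⟨_, SMulMemClass.smul_mem _
      (lowerBlock_mem_splitSpecialUnitary (conjTranspose_single_sub_single k j)),
      (v.complexify_L_eq_action j k).symm⟩
  · exact ⟨_, lowerBlock_mem_splitSpecialUnitary (conjTranspose_single_I j),
      (v.complexify_V j).symm⟩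
  · rw [v.isAdjointPair_unique hST (v.isAdjointPair_L j k)]
    exact ⟨_, SMulMemClass.smul_mem _
      (upperBlock_mem_splitSpecialUnitary (conjTranspose_single_sub_single j k)),
      (v.complexify_adjointL j k).symm⟩
  · rw [v.isAdjointPair_unique hST (v.isAdjointPair_V j)]
    exact ⟨_, neg_mem (upperBlock_mem_splitSpecialUnitary (conjTranspose_single_I j)),
      (v.complexify_adjointV j).symm⟩

theorem exists_complexify_eq (hs : 2 ≤ s)
    {M : Matrix (Fin (s + 1) ⊕ Fin (s + 1)) (Fin (s + 1) ⊕ Fin (s + 1)) ℂ}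
    (hM : M ∈ splitSpecialUnitary (Fin (s + 1))) :
    ∃ T ∈ v.fibreAlgebra, complexify T = v.action M := by
  suffices splitSpecialUnitary (Fin (s + 1)) ≤ (v.fibreAlgebra.map complexify).comap v.action from
    this hM
  have hcard : ∀ j l : Fin (s + 1), ∃ k, k ≠ j ∧ k ≠ l := fun j l => by
    obtain ⟨k, hk⟩ := Finset.exists_mem_notMem_of_card_lt_card (s := {j, l})
      (t := (Finset.univ : Finset (Fin (s + 1))))
      (lt_of_le_of_lt Finset.card_le_two (by rw [Finset.card_univ, Fintype.card_fin]; omega))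
    exact ⟨k, by simpa using hk⟩
  have hsign : ∀ {N : Matrix (Fin (s + 1) ⊕ Fin (s + 1)) (Fin (s + 1) ⊕ Fin (s + 1)) ℂ}
      {j k : Fin (s + 1)}, pairSign j k • N ∈ (v.fibreAlgebra.map complexify).comap v.action →
      N ∈ (v.fibreAlgebra.map complexify).comap v.action := fun {N j k} hN => by
    have := LieSubalgebra.smul_mem _ (pairSign j k) hN
    rwa [smul_smul, pairSign_mul_self, one_smul] at this
  refine splitSpecialUnitary_le hcard 0 (fun j => ?_) (fun j => ?_) (fun j k hjk => ?_)
    fun j k hjk => ?_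
  · exact ⟨_, v.V_mem_fibreAlgebra j, v.complexify_V j⟩
  · exact neg_mem_iff.mp ⟨_, v.adjointV_mem_fibreAlgebra j, v.complexify_adjointV j⟩
  · exact hsign ⟨_, v.L_mem_fibreAlgebra hjk.symm, v.complexify_L_eq_action k j⟩
  · exact hsign ⟨_, v.adjointL_mem_fibreAlgebra hjk, v.complexify_adjointL j k⟩

theorem baseChange_mem_weightSpace {T : Module.End ℝ (ExteriorAlgebra ℝ W)}
    (hT : T ∈ v.fibreAlgebra) {x : ℂ ⊗[ℝ] ExteriorAlgebra ℝ W} (hx : x ∈ v.weightSpace (-s)) :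
    T.baseChange ℂ x ∈ v.weightSpace (-s) := by
  obtain ⟨M, -, hM⟩ := v.exists_action_eq hT
  rw [mem_weightSpace_iff] at hx ⊢
  rw [← complexify_apply, ← hM]
  refine (Submodule.span_le.mpr ?_ : _ ≤ (Submodule.span ℂ (Set.range v.c)).comap (v.action M)) hx
  rintro _ ⟨b, rfl⟩
  rw [SetLike.mem_coe, Submodule.mem_comap, action_c]
  exact Submodule.sum_mem _ fun a _ => Submodule.smul_mem _ _ (Submodule.subset_span ⟨a, rfl⟩)

theorem toMatrix_restrict {T : Module.End ℝ (ExteriorAlgebra ℝ W)}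
    (hT : ∀ x ∈ v.weightSpace (-s), T.baseChange ℂ x ∈ v.weightSpace (-s))
    {M : Matrix (Fin (s + 1) ⊕ Fin (s + 1)) (Fin (s + 1) ⊕ Fin (s + 1)) ℂ}
    (hM : v.action M = complexify T) :
    LinearMap.toMatrix v.weightBasis v.weightBasis ((T.baseChange ℂ).restrict hT) = M := by
  ext a b
  rw [LinearMap.toMatrix_apply]
  have : (T.baseChange ℂ).restrict hT (v.weightBasis b) = ∑ a, M a b • v.weightBasis a := by
    apply Subtype.ext
    rw [LinearMap.coe_restrict_apply, weightBasis_apply, ← complexify_apply, ← hM, action_c]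
    simp [weightBasis_apply]
  rw [this, map_sum, Finsupp.finsetSum_apply]
  simp [Finsupp.single_apply]

theorem action_injective : Function.Injective v.action := fun M N hMN => by
  ext a b
  have : ∑ a, (M a b - N a b) • v.c a = 0 := by
    simp only [sub_smul, Finset.sum_sub_distrib, ← action_c, hMN, sub_self]
  exact sub_eq_zero.mp (Fintype.linearIndependent_iff.mp v.linearIndependent_c _ this a)

/-- The representation of the fibre algebra by matrices in the basis `c` of the space of forms of
weight `-s`. -/
def weightRepresentation : v.fibreAlgebra →ₗ⁅ℝ⁆
    Matrix (Fin (s + 1) ⊕ Fin (s + 1)) (Fin (s + 1) ⊕ Fin (s + 1)) ℂ :=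
  have key : ∀ T : v.fibreAlgebra, v.action (LinearMap.toMatrix v.weightBasis v.weightBasis
      ((T.1.baseChange ℂ).restrict fun _ hx => v.baseChange_mem_weightSpace T.2 hx)) =
      complexify T.1 := fun T => by
    obtain ⟨M, -, hM⟩ := v.exists_action_eq T.2
    rw [v.toMatrix_restrict _ hM, hM]
  { toFun := fun T => LinearMap.toMatrix v.weightBasis v.weightBasis
      ((T.1.baseChange ℂ).restrict fun _ hx => v.baseChange_mem_weightSpace T.2 hx)
    map_add' := fun S T => v.action_injective <| by
      rw [map_add, key, key, key, ← map_add]; rfl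
    map_smul' := fun c T => v.action_injective <| by
      rw [map_smul, key, key, ← map_smul]; rfl
    map_lie' := fun {S T} => v.action_injective <| by
      rw [LieHom.map_lie, key, key, key, ← LieHom.map_lie]; rfl }

theorem weightRepresentation_apply (T : v.fibreAlgebra) :
    v.weightRepresentation T = LinearMap.toMatrix v.weightBasis v.weightBasis
      ((T.1.baseChange ℂ).restrict fun _ hx => v.baseChange_mem_weightSpace T.2 hx) := rfl

theorem action_weightRepresentation (T : v.fibreAlgebra) :
    v.action (v.weightRepresentation T) = complexify T.1 := by
  obtain ⟨M, -, hM⟩ := v.exists_action_eq T.2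
  rw [weightRepresentation_apply, v.toMatrix_restrict _ hM, hM]

theorem weightRepresentation_injective : Function.Injective v.weightRepresentation :=
  fun S T hST => Subtype.ext <| baseChange_injective <| by
    have := congrArg v.action hST
    rwa [action_weightRepresentation, action_weightRepresentation] at this

theorem range_weightRepresentation (hs : 2 ≤ s) :
    Set.range v.weightRepresentation = splitSpecialUnitary (Fin (s + 1)) := by
  ext M
  constructor
  · rintro ⟨T, rfl⟩
    obtain ⟨M, hM, hMT⟩ := v.exists_action_eq T.2
    rwa [v.action_injective ((v.action_weightRepresentation T).trans hMT.symm)]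
  · intro hM
    obtain ⟨T, hT, hTM⟩ := v.exists_complexify_eq hs hM
    exact ⟨⟨T, hT⟩, v.action_injective ((v.action_weightRepresentation ⟨T, hT⟩).trans hTM)⟩

end AdaptedCoframe

end SKahler

end

theorem mainTheorem6
    {E : Type*} [NormedAddCommGroup E] [NormedSpace ℝ E] [FiniteDimensional ℝ E]
    {H : Type*} [TopologicalSpace H] {I : ModelWithCorners ℝ E H}
    {X : Type*} [TopologicalSpace X] [ChartedSpace H X] [IsManifold I ∞ X]
    (s : ℕ) (hs : 2 ≤ s) (K : SKahler.PointwiseSKahlerStructure I X s) (p : X) (v : K.Coframe p) :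
    ∃ c : Module.Basis (Fin (s + 1) ⊕ Fin (s + 1)) ℂ (v.weightSpace (-s)),
      (∀ i, (c i : ℂ ⊗[ℝ] ExteriorAlgebra ℝ (SKahler.Cotangent I p)) = v.c i) ∧
      ∃ hinv : ∀ T ∈ v.fibreAlgebra, ∀ x ∈ v.weightSpace (-s),
          T.baseChange ℂ x ∈ v.weightSpace (-s),
        ∃ ρ : v.fibreAlgebra →ₗ⁅ℝ⁆
            Matrix (Fin (s + 1) ⊕ Fin (s + 1)) (Fin (s + 1) ⊕ Fin (s + 1)) ℂ,
          (∀ T : v.fibreAlgebra, ρ T = LinearMap.toMatrix c c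
            ((T.1.baseChange ℂ).restrict (hinv T.1 T.2))) ∧
          Function.Injective ρ ∧
          Set.range ρ = {M | ∃ D H₁ H₂ : Matrix (Fin (s + 1)) (Fin (s + 1)) ℂ,
            D.trace.im = 0 ∧ H₁ᴴ = -H₁ ∧ H₂ᴴ = -H₂ ∧
            M = Matrix.fromBlocks D H₂ H₁ (-Dᴴ)} := by
  refine ⟨v.weightBasis, v.weightBasis_apply, fun T hT x hx => v.baseChange_mem_weightSpace hT hx,
    v.weightRepresentation, v.weightRepresentation_apply, v.weightRepresentation_injective, ?_⟩
  rw [v.range_weightRepresentation hs]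
  ext M
  exact SKahler.mem_splitSpecialUnitary_iff
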